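/- Let $N,D\in\mathbb C[x]$ be coprime and let $h=N/D\in\mathbb C[[x]]$, that is, $h=\sum_{i\ge 0}h_ix^i$ with $D\,h=N$. Let $H_r(h)=\det(h_{i+j})_{0\le i,j\le r-1}$, $d=\max(\deg D,\deg N+1)$ and $\nu=\deg N-\deg D+1$. For a polynomial $f$ put $\operatorname{Rv}f(x)=x^{\deg f}f(1/x)$. Algorithm CompHD takes $n$ and the coefficients of $N$ and $D$, and proceeds as follows. If $n>d$, it sets $H_r(h)=0$ for $d<r\le n$ and replaces $n$ by $d$. 1. Put $f_0=x^{\max(\nu,0)}\operatorname{Rv}D$ and $f_1=x^{\max(-\nu,0)}\operatorname{Rv}N$. 2. Let $f_i=B_if_{i+1}-f_{i+2}$ with $\deg f_{i+2}<\deg f_{i+1}$ be the generalized Sturm sequence of $f_0,f_1$, and let $m_i=\deg B_i$ and $b_i$ be the leading coefficient of $B_i$. By the half-GCD algorithm (with polynomial products by the fast Fourier transform and power series inverses by Newton iteration), compute those $B_0,B_1,\dots,B_{\kappa-1}$ for which $m_0+\dots+m_{\kappa-1}\le n$, with $\kappa$ as large as possible. 3. Starting from $H_0=1$, with $r=m_0+\dots+m_{j-1}$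 for $j=0,1,\dots,\kappa-1$, put $$H_{r+m_j}=(-1)^{m_j(m_j-1)/2}\Bigl(b_j\prod_{i=0}^{j-1}b_i^2\Bigr)^{-m_j}H_r ,$$ the power being computed by repeated squaring, and $H_t=0$ for the remaining $1\le t\le n$. Cost is the number of additions, subtractions, multiplications, divisions and zero tests in $\mathbb C$, plus the number of loaded constants of $\mathbb C$ (small integers, inverses of powers of $2$, and powers of the roots of unity $e^{2\pi i/2^e}$); rearranging coefficients is free. Theorem. There is an absolute constant $C>0$ such that, for all $n$, $N$, $D$, $h$ as above, Algorithm CompHD never divides by zero and returns exactly $H_1(h),H_2(h),\dots,H_n(h)$; and, with $m=\min(n,d)$, its cost is at most $C\,m\log^2m$ if $m\ge2$ and at most $C$ if $m\le1$. In particular, for $n\le d$ it computes $H_1(h),\dots,H_n(h)$ in $O(n\log^2n)$ field operations. Moreover, the half-GCD step returns exactly the quotients $B_0,\dots,B_{\kappa-1}$ described in Step 2, with the same bounds on its cost. -/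

import Mathlib

namespace HankelAlg

/-! ### Programs that count field operations -/

/-- The four binary field operations. -/
inductive ArithOp where
  | add
  | sub
  | mul
  | div

/-- An algebraic computation tree. `V` is the type of the field elements a program handles: its
inputs, and the results of its instructions. The only instructions are loading a constant of `K`,
one of the four field operations on two elements of `V`, and a test whether an element of `V`
vanishes. All algorithms below are generic in `V`, so they have no other access to field
elements; moving, copying and indexing stored elements is not a field operation. -/
inductive FieldProg (K V α : Type) : Type where
  | ret (a : α) : FieldProg K V α
  | lit (c : K) (next : V → FieldProg K V α) : FieldProg K V α
  | arith (o : ArithOp) (x y : V) (next : V → FieldProg K V α) : FieldProg K V α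
  | isZero (x : V) (next : Bool → FieldProg K V α) : FieldProg K V α

namespace FieldProg

/-- Sequential composition of programs. -/
def bind {K V α β : Type} : FieldProg K V α → (α → FieldProg K V β) → FieldProg K V β
  | ret a, f => f a
  | lit c next, f => lit c (fun v => bind (next v) f)
  | arith o x y next, f => arith o x y (fun v => bind (next v) f)
  | isZero x next, f => isZero x (fun b => bind (next b) f)

instance {K V : Type} : Monad (FieldProg K V) where
  pure := ret
  bind := bind

/-- Result and number of instructions of a run over the field `K`. Constants, field operations and
zero tests cost one each. A division by zero makes the run fail. -/
def run {K α : Type} [Field K] [DecidableEq K] : FieldProg K K α → Option (α × ℕ)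
  | ret a => some (a, 0)
  | lit c next => (run (next c)).map (fun p => (p.1, p.2 + 1))
  | arith .add x y next => (run (next (x + y))).map (fun p => (p.1, p.2 + 1))
  | arith .sub x y next => (run (next (x - y))).map (fun p => (p.1, p.2 + 1))
  | arith .mul x y next => (run (next (x * y))).map (fun p => (p.1, p.2 + 1))
  | arith .div x y next =>
      if y = 0 then none else (run (next (x / y))).map (fun p => (p.1, p.2 + 1))
  | isZero x next => (run (next (decide (x = 0)))).map (fun p => (p.1, p.2 + 1))

end FieldProg

/-- The instruction loading a constant. -/
def const {K V : Type} (c : K) : FieldProg K V V := .lit c .ret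

/-- The instruction performing one field operation. -/
def arith {K V : Type} (o : ArithOp) (x y : V) : FieldProg K V V := .arith o x y .ret

/-- The zero test. -/
def testZero {K V : Type} (x : V) : FieldProg K V Bool := .isZero x .ret

/-- Entrywise operation on two lists (cut to the shorter one). -/
def zipArith {K V : Type} (o : ArithOp) : List V → List V → FieldProg K V (List V)
  | x :: xs, y :: ys => do
      let z ← arith o x y
      let zs ← zipArith o xs ys
      return z :: zs
  | _, _ => return []

/-- Multiply all entries of a list by `c`. -/
def scale {K V : Type} (c : V) : List V → FieldProg K V (List V)
  | [] => return []
  | x :: xs => do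
      let y ← arith .mul c x
      let ys ← scale c xs
      return y :: ys

/-- The number of zeros in front of the first nonzero entry, `none` if all entries vanish. -/
def leadingZeros {K V : Type} : List V → FieldProg K V (Option ℕ)
  | [] => return none
  | x :: xs => do
      let b ← testZero x
      if b then
        let i ← leadingZeros xs
        return i.map (· + 1)
      else
        return some 0

/-- `x ^ m` by repeated squaring. -/
def power {K V : Type} [Field K] (x : V) (m : ℕ) : FieldProg K V V :=
  if h : m = 0 then const 1
  else do
    let y ← power x (m / 2)
    let z ← arith .mul y y
    if m % 2 = 1 then arith .mul z x else return z
termination_by m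
decreasing_by exact Nat.div_lt_self (Nat.pos_of_ne_zero h) Nat.one_lt_two

/-! ### Fast arithmetic of power series

A list `[a₀, a₁, …]` stands for `a₀ + a₁ x + …`. The parameter `root` supplies, for every `e`, a
primitive `2 ^ e`-th root of unity `root e` of `K`, with `root (e + 1) ^ 2 = root e`. -/

/-- The entries of a list at the even positions `0, 2, 4, …`. -/
def evens {V : Type} : List V → List V
  | [] => []
  | [a] => [a]
  | a :: _ :: l => a :: evens l

/-- Multiply the entries by `w ^ j`, `w ^ (j + 1)`, …. -/
def twiddle {K V : Type} [Field K] (w : K) : ℕ → List V → FieldProg K V (List V)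
  | _, [] => return []
  | j, x :: xs => do
      let c ← const (w ^ j)
      let y ← arith .mul c x
      let ys ← twiddle w (j + 1) xs
      return y :: ys

/-- Fast Fourier transform: the values of a polynomial with `2 ^ e` coefficients at the powers
of `root e`. -/
def fft {K V : Type} [Field K] (root : ℕ → K) : ℕ → List V → FieldProg K V (List V)
  | 0, xs => return xs
  | e + 1, xs => do
      let u ← fft root e (evens xs)
      let v ← fft root e (evens xs.tail)
      let t ← twiddle (root (e + 1)) 0 v
      let l ← zipArith .add u t
      let r ← zipArith .sub u t
      return l ++ r

/-- Product of two polynomials, by fast Fourier transform; the output has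
`a.length + b.length - 1` coefficients. -/
def mulFFT {K V : Type} [Field K] (root : ℕ → K) (a b : List V) : FieldProg K V (List V) := do
  let len := a.length + b.length - 1
  let e := Nat.clog 2 len
  let zero ← const (0 : K)
  let u ← fft root e (a ++ List.replicate (2 ^ e - a.length) zero)
  let v ← fft root e (b ++ List.replicate (2 ^ e - b.length) zero)
  let p ← zipArith .mul u v
  let q ← fft (fun i => (root i)⁻¹) e p
  let c ← const (((2 : K) ^ e)⁻¹)
  scale c (q.take len)

/-- Inverse of a power series modulo `x ^ n`, by Newton iteration `g ↦ g (2 - a g)`. The list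
`a` holds at least `n` coefficients, the first of which is nonzero. -/
def invNewton {K V : Type} [Field K] (root : ℕ → K) (n : ℕ) (a : List V) :
    FieldProg K V (List V) :=
  if _h : n ≤ 1 then do
    let one ← const (1 : K)
    zipArith .div [one] a
  else do
    let g ← invNewton root ((n + 1) / 2) a
    let p ← mulFFT root (a.take n) g
    let zero ← const (0 : K)
    let two ← const (2 : K)
    let q ← zipArith .sub (two :: List.replicate (n - 1) zero) (p.take n)
    let r ← mulFFT root g q
    return r.take n
termination_by n
decreasing_by omega

/-! ### The half-GCD algorithm

Polynomials are stored by descending coefficients, so that the first entries of a list are the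
high-degree part, and the list of `f` read as a power series is `Rv f`. A pair `(f, g)` with
`deg g < deg f` is stored as two lists aligned at `deg f`: the list of `f` starts with its leading
coefficient, the list of `g` with the coefficient (zero) of `g` at `deg f`. One division step
`(f, g) ↦ (g, B g - f)` with `m = deg B` turns the two series `(F, G)` into
`x⁻²ᵐ (xᵐ G, Rv B · G - xᵐ F)`. -/

/-- Output of the half-GCD: a list of consecutive quotients (descending coefficients), the sum `s`
of their degrees, and the matrix `(w₁₁, w₁₂; w₂₁, w₂₂)` of polynomials of formal degree `s` that
takes `(F, G)` to `x²ˢ` times the pair reached after dividing by all these quotients. -/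
structure HalfGCD (V : Type) where
  quots : List (List V)
  s : ℕ
  w₁₁ : List V
  w₁₂ : List V
  w₂₁ : List V
  w₂₂ : List V

/-- `a * b + c * d` for lists with `a.length + b.length = c.length + d.length`. -/
def mulAdd {K V : Type} [Field K] (root : ℕ → K) (a b c d : List V) :
    FieldProg K V (List V) := do
  let p ← mulFFT root a b
  let q ← mulFFT root c d
  zipArith .add p q

/-- The half-GCD algorithm: from the `2 k + 1` highest coefficients of a pair `(f, g)` it computes
the first quotients of the sequence `f, g, …` as long as their degrees add up to at most `k`.
It runs recursively on the high-degree part for `k / 2`, applies the resulting matrix to the given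
pair, makes one division step, and runs recursively on the high-degree part of the new pair. -/
def halfGCD {K V : Type} [Field K] (root : ℕ → K) (k : ℕ) (F G : List V) :
    FieldProg K V (HalfGCD V) :=
  if _h : k = 0 then do
    let zero ← const (0 : K)
    let one ← const (1 : K)
    return ⟨[], 0, [one], [zero], [zero], [one]⟩
  else do
    let R ← halfGCD root (k / 2) (F.take (2 * (k / 2) + 1)) (G.take (2 * (k / 2) + 1))
    let F₁' ← mulAdd root R.w₁₁ F R.w₁₂ G
    let G₁' ← mulAdd root R.w₂₁ F R.w₂₂ G
    let F₁ := (F₁'.take (2 * k + 1)).drop (2 * R.s)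
    let G₁ := (G₁'.take (2 * k + 1)).drop (2 * R.s)
    match ← leadingZeros ((G₁.take (k - R.s + 1)).drop 1) with
    | none => return R
    | some i =>
      -- the next quotient `B` has degree `m`
      let m := i + 1
      let F₂ := G₁.drop m
      let c ← invNewton root (m + 1) (F₂.take (m + 1))
      let B' ← mulFFT root (F₁.take (m + 1)) c
      let B := B'.take (m + 1)
      let P ← mulFFT root B F₂
      let G₂' ← zipArith .sub (P.take F₂.length) (F₁.take F₂.length)
      let G₂ := G₂'.drop m
      -- the matrix including this division step
      let zero ← const (0 : K)
      let shift := List.replicate m zero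
      let p₁ ← mulFFT root B R.w₂₁
      let p₂ ← mulFFT root B R.w₂₂
      let u₁₁ := shift ++ R.w₂₁
      let u₁₂ := shift ++ R.w₂₂
      let u₂₁ ← zipArith .sub p₁ (shift ++ R.w₁₁)
      let u₂₂ ← zipArith .sub p₂ (shift ++ R.w₁₂)
      let k₂ := k - (R.s + (i + 1))
      let T ← halfGCD root k₂ (F₂.take (2 * k₂ + 1)) (G₂.take (2 * k₂ + 1))
      let v₁₁ ← mulAdd root T.w₁₁ u₁₁ T.w₁₂ u₂₁
      let v₁₂ ← mulAdd root T.w₁₁ u₁₂ T.w₁₂ u₂₂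
      let v₂₁ ← mulAdd root T.w₂₁ u₁₁ T.w₂₂ u₂₁
      let v₂₂ ← mulAdd root T.w₂₁ u₁₂ T.w₂₂ u₂₂
      return ⟨R.quots ++ B :: T.quots, R.s + m + T.s, v₁₁, v₁₂, v₂₁, v₂₂⟩
termination_by k
decreasing_by
  · exact Nat.div_lt_self (Nat.pos_of_ne_zero _h) Nat.one_lt_two
  · omega

/-! ### Algorithm CompHD -/

/-- Step 1. From the descending coefficient lists of `N` and `D`: the lists of
`f₀ = x ^ max(ν, 0) Rv D` and `f₁ = x ^ max(-ν, 0) Rv N`, where `ν = deg N - deg D + 1`, by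
descending coefficients. The list of `f₁` starts at degree `deg f₀ - 1`. -/
def sturmInput {V : Type} (zero : V) (N D : List V) : List V × List V :=
  (D.reverse ++ List.replicate (N.length - (D.length - 1)) zero,
    N.reverse ++ List.replicate ((D.length - 1) - N.length) zero)

/-- Step 2. The quotients `B₀, B₁, …` of the generalized Sturm sequence of `f₀, f₁` whose degrees
add up to at most `n`, each by descending coefficients. Only the `2 n + 1` highest coefficients
of `f₀` and `f₁` are passed to the half-GCD algorithm. -/
def sturmQuotients {K V : Type} [Field K] (root : ℕ → K) (n : ℕ) (zero : V) (f₀ f₁ : List V) :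
    FieldProg K V (List (List V)) := do
  let R ← halfGCD root n
    ((f₀ ++ List.replicate (2 * n) zero).take (2 * n + 1))
    ((zero :: f₁ ++ List.replicate (2 * n) zero).take (2 * n + 1))
  return R.quots

/-- Step 3. The recursion
`H_{r+m} = (-1) ^ (m (m - 1) / 2) * (b * ∏ bᵢ²)⁻ᵐ * H_r`, and `H_t = 0` for `r < t < r + m`, where
`m` and `b` are degree and leading coefficient of the current quotient. The argument `H` is `H_r`
and `c` is the product of the squares of the leading coefficients of the earlier quotients. -/
def hankelRec {K V : Type} [Field K] (zero : V) : List (List V) → V → V → FieldProg K V (List V)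
  | [], _, _ => return []
  | [] :: Bs, H, c => hankelRec zero Bs H c
  | (b :: B) :: Bs, H, c => do
      let m := B.length
      let p ← arith .mul c b
      let q ← power p m
      let H' ← arith .div H q
      let H'' ← (if (m * (m - 1) / 2) % 2 = 1 then arith .sub zero H' else return H')
      let c' ← arith .mul p b
      let Hs ← hankelRec zero Bs H'' c'
      return List.replicate (m - 1) zero ++ H'' :: Hs

/-- Algorithm CompHD: the Hankel determinants `[H_1, …, H_n]` of `N / D`, where `N` and `D` are
given by their descending coefficient lists. Here `d = max (deg D, deg N + 1)`, and `n` is replaced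
by `d` if it is larger, the determinants of order greater than `d` being set to zero. -/
def compHD {K V : Type} [Field K] (root : ℕ → K) (n : ℕ) (N D : List V) :
    FieldProg K V (List V) := do
  let zero ← const (0 : K)
  let one ← const (1 : K)
  let d := max (D.length - 1) N.length
  let f := sturmInput zero N D
  let Bs ← sturmQuotients root (min n d) zero f.1 f.2
  let Hs ← hankelRec zero Bs one one
  return Hs ++ List.replicate (n - Hs.length) zero

/-! ### The mathematical objects -/

/-- The Hankel determinant `H_n(h) = det (h_{i+j})_{0 ≤ i, j ≤ n-1}`. -/
noncomputable def hankelDet {K : Type} [Field K] (h : PowerSeries K) (n : ℕ) : K :=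
  Matrix.det (Matrix.of fun i j : Fin n => PowerSeries.coeff ((i : ℕ) + (j : ℕ)) h)

/-- The generalized Sturm sequence: `f_{i+2} = - rem (f_i, f_{i+1})`. -/
noncomputable def sturmSeq {K : Type} [Field K] (f₀ f₁ : Polynomial K) : ℕ → Polynomial K
  | 0 => f₀
  | 1 => f₁
  | i + 2 => -(sturmSeq f₀ f₁ i % sturmSeq f₀ f₁ (i + 1))

/-- The quotient `B_i` of `f_i` by `f_{i+1}`, so that `f_i = B_i f_{i+1} - f_{i+2}`. -/
noncomputable def sturmQuot {K : Type} [Field K] (f₀ f₁ : Polynomial K) (i : ℕ) : Polynomial K :=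
  sturmSeq f₀ f₁ i / sturmSeq f₀ f₁ (i + 1)

/-- `f₀ = x ^ max(ν, 0) Rv D`, where `ν = deg N - deg D + 1`. -/
noncomputable def sturmF₀ {K : Type} [Field K] (N D : Polynomial K) : Polynomial K :=
  Polynomial.X ^ ((N.natDegree + 1) - D.natDegree) * D.reverse

/-- `f₁ = x ^ max(-ν, 0) Rv N`, where `ν = deg N - deg D + 1`. -/
noncomputable def sturmF₁ {K : Type} [Field K] (N D : Polynomial K) : Polynomial K :=
  Polynomial.X ^ (D.natDegree - (N.natDegree + 1)) * N.reverse

/-- The primitive `2 ^ e`-th root of unity `exp (2 π i / 2 ^ e)`. -/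
noncomputable def complexRoot (e : ℕ) : ℂ :=
  Complex.exp (2 * Real.pi * Complex.I / 2 ^ e)

end HankelAlg

/-!
Everything is done over a field `K` with primitive `2 ^ e`-th roots of unity, and stored lists are
read as power series: `ser l` is the series of a list, and `jet n F` the list of the first `n`
coefficients of `F`. The relation `Computes p a c` (the program `p` returns `a` without dividing by
zero, at cost at most `c`) composes along `bind`, so that correctness and cost are proved together.

*Arithmetic.* The fast Fourier transform evaluates a polynomial at all powers of the root by the
splitting `p(z) = p₀(z²) + z p₁(z²)`; orthogonality of characters inverts it, which gives the product
(`Computes.mulFFT`). Newton iteration squares the error of an approximate inverse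
(`Computes.invNewton`).

*Half-GCD.* A pair of polynomials `f, g` enters as the pair of power series `F = x ^ deg f * f (1 / x)`
and `G = x ^ deg f * g (1 / x)`. Division with remainder then makes sense for arbitrary power series
with `F(0) ≠ 0` and `G(0) = 0` (`EuclidStep`): the quotient of degree `m` depends only on the first
`m + 1` coefficients of `F` and of `G / x ^ m`. Proved for all power series, the correctness of
the half-GCD algorithm (`exists_computes_halfGCD`) applies to its recursive calls on truncated lists
without any comparison of the division chains of two pairs. The first recursive call stops only when
the next quotient exceeds degree `k / 2`, so the second one is made for at most `k / 2` as well; the cost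
satisfies `T(k) ≤ 2 T(k / 2) + O(k log k)`, whence `T(k) = O(k log² k)`. Division steps are unique, and
the polynomial Sturm sequence provides them, so the quotients are those of the Sturm sequence
(`EuclidChain.sturm`).

*Hankel determinants.* One division step writes `x h(x) = x ^ m / w(x)` with
`w(x) = B(x) - x ^ m * x h'(x)`. The generating function of the Hankel matrix of `h` is
`(x h(x) - y h(y)) / (x - y)`. Multiplying it by `w(x) w(y)`, which multiplies the matrix by triangular
Toeplitz matrices from both sides, turns it into
`(x ^ m B(y) - y ^ m B(x)) / (x - y) + x ^ m y ^ m * (x h'(x) - y h'(y)) / (x - y)`: a block diagonal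
matrix with an antitriangular `m × m` block and the Hankel matrix of `h'` (`hankelDet_add`). This
is the recursion of the algorithm (`EuclidChain.computes_hankelRec`). Orders in front of a quotient of
too large a degree vanish since `h` starts with zeros there, and orders above `d` since the
coefficients of `N / D` satisfy a linear recursion of order `d` (`hankelDet_eq_zero_of_rational`).
-/

namespace HankelAlg

/-! ### Runs of programs -/

section Programs

variable {K : Type} [Field K] [DecidableEq K] {α β : Type}

/-- The program `p` does not divide by zero, returns `a`, and executes at most `c` instructions. -/
def Computes (p : FieldProg K K α) (a : α) (c : ℕ) : Prop :=
  ∃ c' ≤ c, p.run = some (a, c')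

theorem FieldProg.run_bind {p : FieldProg K K α} {f : α → FieldProg K K β} {a : α} {b : β}
    {c c' : ℕ} (hp : p.run = some (a, c)) (hf : (f a).run = some (b, c')) :
    (p >>= f).run = some (b, c + c') := by
  change (FieldProg.bind p f).run = _
  induction p generalizing c with
  | ret x =>
    simp only [FieldProg.run, Option.some.injEq, Prod.mk.injEq] at hp
    obtain ⟨rfl, rfl⟩ := hp
    simpa [FieldProg.bind] using hf
  | lit k next ih =>
    simp only [FieldProg.run, Option.map_eq_some_iff, FieldProg.bind, Prod.exists,
      Prod.mk.injEq] at hp ⊢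
    obtain ⟨x, y, h, rfl, rfl⟩ := hp
    exact ⟨_, _, ih _ h, rfl, by omega⟩
  | arith o x y next ih =>
    cases o
    case div =>
      by_cases hy : y = 0
      · simp [FieldProg.run, hy] at hp
      simp only [FieldProg.run, hy, if_false, Option.map_eq_some_iff, FieldProg.bind, Prod.exists,
        Prod.mk.injEq] at hp ⊢
      obtain ⟨x, y, h, rfl, rfl⟩ := hp
      exact ⟨_, _, ih _ h, rfl, by omega⟩
    all_goals
      simp only [FieldProg.run, Option.map_eq_some_iff, FieldProg.bind, Prod.exists,
        Prod.mk.injEq] at hp ⊢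
      obtain ⟨x, y, h, rfl, rfl⟩ := hp
      exact ⟨_, _, ih _ h, rfl, by omega⟩
  | isZero x next ih =>
    simp only [FieldProg.run, Option.map_eq_some_iff, FieldProg.bind, Prod.exists,
      Prod.mk.injEq] at hp ⊢
    obtain ⟨x, y, h, rfl, rfl⟩ := hp
    exact ⟨_, _, ih _ h, rfl, by omega⟩

namespace Computes

theorem bind {p : FieldProg K K α} {f : α → FieldProg K K β} {a : α} {b : β} {c c' : ℕ}
    (hp : Computes p a c) (hf : Computes (f a) b c') : Computes (p >>= f) b (c + c') := by
  obtain ⟨x, hx, h⟩ := hp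
  obtain ⟨y, hy, h'⟩ := hf
  exact ⟨x + y, by omega, FieldProg.run_bind h h'⟩

theorem mono {p : FieldProg K K α} {a : α} {c c' : ℕ} (hp : Computes p a c) (h : c ≤ c') :
    Computes p a c' := by
  obtain ⟨x, hx, hr⟩ := hp
  exact ⟨x, hx.trans h, hr⟩

theorem pure (a : α) : Computes (Pure.pure a : FieldProg K K α) a 0 := ⟨0, le_rfl, rfl⟩

theorem const (c : K) : Computes (HankelAlg.const c) c 1 := ⟨1, le_rfl, rfl⟩

theorem add (x y : K) : Computes (arith .add x y) (x + y) 1 := ⟨1, le_rfl, rfl⟩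

theorem sub (x y : K) : Computes (arith .sub x y) (x - y) 1 := ⟨1, le_rfl, rfl⟩

theorem mul (x y : K) : Computes (arith .mul x y) (x * y) 1 := ⟨1, le_rfl, rfl⟩

theorem div (x : K) {y : K} (hy : y ≠ 0) : Computes (arith .div x y) (x / y) 1 :=
  ⟨1, le_rfl, by simp [arith, FieldProg.run, hy]⟩

theorem testZero (x : K) : Computes (HankelAlg.testZero x) (decide (x = 0)) 1 :=
  ⟨1, le_rfl, rfl⟩

theorem zipArith_add : ∀ xs ys : List K,
    Computes (zipArith .add xs ys) (List.zipWith (· + ·) xs ys) xs.length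
  | x :: xs, y :: ys => by
    rw [zipArith]
    exact mono (bind (add x y) (bind (zipArith_add xs ys) (pure _))) (by simp; omega)
  | [], _ => by simpa [zipArith] using pure _
  | _ :: _, [] => by simpa [zipArith] using (pure _).mono (Nat.zero_le _)

theorem zipArith_sub : ∀ xs ys : List K,
    Computes (zipArith .sub xs ys) (List.zipWith (· - ·) xs ys) xs.length
  | x :: xs, y :: ys => by
    rw [zipArith]
    exact mono (bind (sub x y) (bind (zipArith_sub xs ys) (pure _))) (by simp; omega)
  | [], _ => by simpa [zipArith] using pure _
  | _ :: _, [] => by simpa [zipArith] using (pure _).mono (Nat.zero_le _)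

theorem zipArith_mul : ∀ xs ys : List K,
    Computes (zipArith .mul xs ys) (List.zipWith (· * ·) xs ys) xs.length
  | x :: xs, y :: ys => by
    rw [zipArith]
    exact mono (bind (mul x y) (bind (zipArith_mul xs ys) (pure _))) (by simp; omega)
  | [], _ => by simpa [zipArith] using pure _
  | _ :: _, [] => by simpa [zipArith] using (pure _).mono (Nat.zero_le _)

theorem scale (c : K) : ∀ xs : List K,
    Computes (HankelAlg.scale c xs) (xs.map (c * ·)) xs.length
  | x :: xs => by
    rw [HankelAlg.scale]
    exact mono (bind (mul c x) (bind (scale c xs) (pure _))) (by simp; omega)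
  | [] => by simpa [HankelAlg.scale] using pure _

/-- The zero tests find either that a list vanishes, or the position of its first nonzero entry. -/
theorem leadingZeros : ∀ xs : List K,
    (Computes (HankelAlg.leadingZeros xs) none xs.length ∧ ∀ i, xs.getD i 0 = 0) ∨
      ∃ i < xs.length, Computes (HankelAlg.leadingZeros xs) (some i) xs.length ∧
        (∀ j < i, xs.getD j 0 = 0) ∧ xs.getD i 0 ≠ 0
  | [] => Or.inl ⟨by simpa [HankelAlg.leadingZeros] using pure _, by simp⟩
  | x :: xs => by
    rw [HankelAlg.leadingZeros]
    by_cases hx : x = 0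
    · have ht : Computes (HankelAlg.testZero x) true 1 := by simpa [hx] using testZero x
      rcases leadingZeros xs with ⟨h, h0⟩ | ⟨i, hi, h, h0, h1⟩
      · refine Or.inl ⟨mono (bind ht (bind h (pure _))) (by simp; omega), ?_⟩
        rintro (_ | i)
        · simpa using hx
        · simpa using h0 i
      · refine Or.inr ⟨i + 1, by simpa using hi,
          mono (bind ht (bind h (pure _))) (by simp; omega), ?_, by simpa using h1⟩
        rintro (_ | j) hj
        · simpa using hx
        · simpa using h0 j (by omega)
    · have ht : Computes (HankelAlg.testZero x) false 1 := by simpa [hx] using testZero x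
      exact Or.inr ⟨0, by simp, mono (bind ht (pure _)) (by simp), by simp, by simpa using hx⟩

theorem power (x : K) (m : ℕ) : Computes (HankelAlg.power x m) (x ^ m) (2 * m + 1) := by
  induction m using Nat.strong_induction_on with
  | _ m ih =>
    rw [HankelAlg.power]
    by_cases hm : m = 0
    · subst hm
      simpa using const (1 : K)
    rw [dif_neg hm]
    have h := ih (m / 2) (Nat.div_lt_self (Nat.pos_of_ne_zero hm) Nat.one_lt_two)
    have hsq : x ^ (m / 2) * x ^ (m / 2) = x ^ (2 * (m / 2)) := by rw [← pow_add, two_mul]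
    rcases Nat.mod_two_eq_zero_or_one m with h2 | h2
    · have hx : x ^ m = x ^ (m / 2) * x ^ (m / 2) := by rw [hsq]; congr 1; omega
      simp only [h2, Nat.zero_ne_one, if_false]
      rw [hx]
      exact mono (bind h (bind (mul _ _) (pure _))) (by omega)
    · have hx : x ^ m = x ^ (m / 2) * x ^ (m / 2) * x := by
        rw [hsq, ← pow_succ]; congr 1; omega
      simp only [h2, if_true]
      rw [hx]
      exact mono (bind h (bind (mul _ _) (mul _ _))) (by omega)

end Computes

end Programs

/-! ### Lists of coefficients and power series -/

section Lists

open PowerSeries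

variable {K : Type} [Field K]

/-- The polynomial `a₀ + a₁ x + …` stored as the list `[a₀, a₁, …]`. -/
noncomputable def listPoly : List K → Polynomial K
  | [] => 0
  | a :: l => Polynomial.C a + Polynomial.X * listPoly l

theorem coeff_listPoly (l : List K) (i : ℕ) : (listPoly l).coeff i = l.getD i 0 := by
  induction l generalizing i with
  | nil => simp [listPoly]
  | cons a l ih =>
    rcases i with _ | i
    · simp [listPoly]
    · simp [listPoly, ih]

/-- The power series `a₀ + a₁ x + …` stored as the list `[a₀, a₁, …]`. -/
noncomputable def ser (l : List K) : K⟦X⟧ := (listPoly l : K⟦X⟧)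

@[simp]
theorem coeff_ser (l : List K) (i : ℕ) : coeff i (ser l) = l.getD i 0 := by
  rw [ser, Polynomial.coeff_coe, coeff_listPoly]

/-- The list of the first `n` coefficients of a power series. -/
noncomputable def jet (n : ℕ) (F : K⟦X⟧) : List K := (List.range n).map fun i => coeff i F

@[simp]
theorem length_jet (n : ℕ) (F : K⟦X⟧) : (jet n F).length = n := by simp [jet]

theorem getD_jet (n : ℕ) (F : K⟦X⟧) (i : ℕ) :
    (jet n F).getD i 0 = if i < n then coeff i F else 0 := by
  split_ifs with h
  · simp [jet, h]
  · simp [jet, not_lt.mp h]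

theorem coeff_ser_jet_of_lt {n i : ℕ} (F : K⟦X⟧) (h : i < n) :
    coeff i (ser (jet n F)) = coeff i F := by
  rw [coeff_ser, getD_jet, if_pos h]

theorem coeff_ser_of_le {l : List K} {i : ℕ} (h : l.length ≤ i) : coeff i (ser l) = 0 := by
  simp [List.getElem?_eq_none h]

/-- Two lists of the same length with the same entries agree. -/
theorem eq_of_getD {l l' : List K} (hl : l.length = l'.length)
    (h : ∀ i < l.length, l.getD i 0 = l'.getD i 0) : l = l' := by
  refine List.ext_getElem hl fun i h1 h2 => ?_
  have := h i h1
  simpa [h1, h2] using this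

theorem jet_congr {n : ℕ} {F G : K⟦X⟧} (h : ∀ i < n, coeff i F = coeff i G) :
    jet n F = jet n G := by
  simpa [jet] using h

theorem jet_ser (l : List K) : jet l.length (ser l) = l :=
  eq_of_getD (by simp) fun i hi => by
    rw [length_jet] at hi
    rw [getD_jet, if_pos hi, coeff_ser]

theorem take_jet (j n : ℕ) (F : K⟦X⟧) : (jet n F).take j = jet (min j n) F := by
  rw [jet, ← List.map_take, List.take_range, jet]

theorem take_jet_of_le {j n : ℕ} (F : K⟦X⟧) (h : j ≤ n) : (jet n F).take j = jet j F := by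
  rw [take_jet, min_eq_left h]

theorem drop_jet_X_pow_mul (j n : ℕ) (F : K⟦X⟧) :
    (jet n (X ^ j * F)).drop j = jet (n - j) F :=
  eq_of_getD (by simp) fun i hi => by
    simp only [List.length_drop, length_jet] at hi
    rw [List.getD_eq_getElem?_getD, List.getElem?_drop, ← List.getD_eq_getElem?_getD, getD_jet,
      getD_jet, if_pos (by omega), if_pos hi, coeff_X_pow_mul', if_pos (by omega),
      Nat.add_sub_cancel_left]

theorem ser_replicate_append (m : ℕ) (l : List K) :
    ser (List.replicate m 0 ++ l) = X ^ m * ser l := by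
  ext i
  rw [coeff_X_pow_mul', coeff_ser]
  split_ifs with h
  · rw [List.getD_append_right _ _ _ _ (by simpa using h)]
    simp
  · rw [List.getD_append _ _ _ _ (by simpa using h)]
    simp [not_le.mp h]

theorem ser_append_replicate (l : List K) (m : ℕ) : ser (l ++ List.replicate m 0) = ser l := by
  ext i
  rw [coeff_ser, coeff_ser]
  rcases lt_or_ge i l.length with h | h
  · rw [List.getD_append _ _ _ _ h]
  · rw [List.getD_append_right _ _ _ _ h, List.getD_eq_default _ _ h]
    rcases lt_or_ge (i - l.length) m with h' | h'
    · simp [h']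
    · exact List.getD_eq_default _ _ (by simpa using h')

theorem ser_zipWith_sub {a b : List K} (h : a.length = b.length) :
    ser (List.zipWith (· - ·) a b) = ser a - ser b := by
  ext i
  rw [map_sub, coeff_ser, coeff_ser, coeff_ser]
  rcases lt_or_ge i a.length with h' | h'
  · simp [h', h ▸ h']
  · rw [List.getD_eq_default _ _ (by simpa [← h] using h'), List.getD_eq_default _ _ h',
      List.getD_eq_default _ _ (h ▸ h'), sub_zero]

theorem ser_zipWith_add {a b : List K} (h : a.length = b.length) :
    ser (List.zipWith (· + ·) a b) = ser a + ser b := by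
  ext i
  rw [map_add, coeff_ser, coeff_ser, coeff_ser]
  rcases lt_or_ge i a.length with h' | h'
  · simp [h', h ▸ h']
  · rw [List.getD_eq_default _ _ (by simpa [← h] using h'), List.getD_eq_default _ _ h',
      List.getD_eq_default _ _ (h ▸ h'), add_zero]

theorem zipWith_sub_jet (n : ℕ) (F G : K⟦X⟧) :
    List.zipWith (· - ·) (jet n F) (jet n G) = jet n (F - G) := by
  simp [jet, List.zipWith_map, List.zipWith_self]

theorem coeff_mul_congr {n : ℕ} {F F' G G' : K⟦X⟧} (hF : ∀ i < n, coeff i F = coeff i F')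
    (hG : ∀ i < n, coeff i G = coeff i G') {i : ℕ} (hi : i < n) :
    coeff i (F * G) = coeff i (F' * G') := by
  rw [coeff_mul, coeff_mul]
  refine Finset.sum_congr rfl fun p hp => ?_
  have := Finset.HasAntidiagonal.mem_antidiagonal.mp hp
  rw [hF _ (by omega), hG _ (by omega)]

end Lists
/-! ### Fast Fourier transform -/

section FFT

variable {K : Type} [Field K]

/-- A compatible system of primitive `2 ^ e`-th roots of unity, each the square of the next. -/
structure IsRootTower (root : ℕ → K) : Prop where
  isPrimitiveRoot : ∀ e, IsPrimitiveRoot (root e) (2 ^ e)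
  sq : ∀ e, root (e + 1) ^ 2 = root e

namespace IsRootTower

variable {root : ℕ → K} (hr : IsRootTower root)
include hr

theorem inv : IsRootTower fun e => (root e)⁻¹ :=
  ⟨fun e => (hr.isPrimitiveRoot e).inv, fun e => by simp only [inv_pow, hr.sq]⟩

theorem pow_two_pow (e : ℕ) : root (e + 1) ^ 2 ^ e = -1 := by
  have h := hr.isPrimitiveRoot (e + 1)
  have h1 : (root (e + 1) ^ 2 ^ e) ^ 2 = 1 := by rw [← pow_mul, ← pow_succ, h.pow_eq_one]
  refine (mul_self_eq_one_iff.mp (by rw [← _root_.sq, h1])).resolve_left ?_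
  exact h.pow_ne_one_of_pos_of_lt (by positivity) (Nat.pow_lt_pow_right one_lt_two (by omega))

theorem two_ne_zero : (2 : K) ≠ 0 := by
  intro h
  have h1 := hr.pow_two_pow 0
  have h2 := hr.isPrimitiveRoot 1
  refine h2.pow_ne_one_of_pos_of_lt (l := 1) (by norm_num) (by norm_num) ?_
  have h3 : (-1 : K) = 1 := by linear_combination -h
  simpa [h3] using h1

/-- Orthogonality of the characters of the cyclic group of order `2 ^ e`. -/
theorem sum_pow_mul_inv_pow (e : ℕ) {i k : ℕ} (hi : i < 2 ^ e) (hk : k < 2 ^ e) :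
    ∑ j ∈ Finset.range (2 ^ e), (root e ^ j) ^ i * ((root e)⁻¹ ^ k) ^ j =
      if i = k then 2 ^ e else 0 := by
  have h := hr.isPrimitiveRoot e
  have h0 : root e ≠ 0 := h.ne_zero (by positivity)
  have hz : ∀ j, (root e ^ j) ^ i * ((root e)⁻¹ ^ k) ^ j = (root e ^ i * (root e)⁻¹ ^ k) ^ j :=
    fun j => by rw [mul_pow, ← pow_mul, ← pow_mul (root e), mul_comm j i]
  simp only [hz]
  split_ifs with hik
  · subst hik
    simp [h0]
  · have hne : root e ^ i * (root e)⁻¹ ^ k ≠ 1 := by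
      intro h1
      refine hik (h.pow_inj hi hk ?_)
      rw [inv_pow, ← div_eq_mul_inv, div_eq_one_iff_eq (pow_ne_zero _ h0)] at h1
      exact h1
    have h1 : (root e ^ i * (root e)⁻¹ ^ k) ^ 2 ^ e = 1 := by
      rw [mul_pow, ← pow_mul, ← pow_mul, mul_comm i, mul_comm k, pow_mul, pow_mul, inv_pow,
        h.pow_eq_one]
      simp
    have h2 := geom_sum_mul (root e ^ i * (root e)⁻¹ ^ k) (2 ^ e)
    rw [h1, sub_self] at h2
    exact (mul_eq_zero.mp h2).resolve_right (sub_ne_zero.mpr hne)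

end IsRootTower

theorem evens_cons {V : Type} (a : V) (l : List V) : evens (a :: l) = a :: evens l.tail := by
  cases l <;> simp [evens]

theorem length_evens {V : Type} (l : List V) : (evens l).length = (l.length + 1) / 2 := by
  have h : (evens l).length = (l.length + 1) / 2 ∧ (evens l.tail).length = l.length / 2 := by
    induction l with
    | nil => simp [evens]
    | cons a l ih =>
      obtain ⟨h1, h2⟩ := ih
      simp only [evens_cons, List.tail_cons, List.length_cons, h1, h2]
      exact ⟨by omega, trivial⟩
  exact h.1

/-- The splitting `p(z) = p₀(z²) + z p₁(z²)` of a polynomial into its even and odd parts. -/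
theorem eval_listPoly_evens (z : K) (l : List K) :
    (listPoly l).eval z =
      (listPoly (evens l)).eval (z ^ 2) + z * (listPoly (evens l.tail)).eval (z ^ 2) := by
  induction l with
  | nil => simp [evens, listPoly]
  | cons a l ih =>
    simp only [evens_cons, List.tail_cons, listPoly, Polynomial.eval_add, Polynomial.eval_C,
      Polynomial.eval_mul, Polynomial.eval_X, ih]
    ring

theorem listPoly_eval_eq_sum (z : K) (l : List K) :
    (listPoly l).eval z = ∑ i ∈ Finset.range l.length, l.getD i 0 * z ^ i := by
  rcases eq_or_ne l [] with rfl | h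
  · simp [listPoly]
  have hlen := List.length_pos_iff.mpr h
  rw [Polynomial.eval_eq_sum_range' (n := l.length)]
  · simp only [coeff_listPoly]
  · refine Nat.lt_of_le_pred hlen (Polynomial.natDegree_le_iff_coeff_eq_zero.mpr fun i hi => ?_)
    rw [coeff_listPoly]
    exact List.getD_eq_default _ _ (by rw [Nat.pred_eq_sub_one] at hi; omega)

variable [DecidableEq K]

theorem Computes.twiddle (w : K) (xs : List K) (j : ℕ) :
    Computes (HankelAlg.twiddle w j xs) (xs.mapIdx fun i x => w ^ (j + i) * x)
      (2 * xs.length) := by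
  induction xs generalizing j with
  | nil => simpa [HankelAlg.twiddle] using Computes.pure _
  | cons x xs ih =>
    rw [HankelAlg.twiddle, List.mapIdx_cons]
    have h := ih (j + 1)
    simp only [add_assoc, add_comm 1] at h
    exact Computes.mono (.bind (.const _) (.bind (.mul _ _) (.bind h (.pure _))))
      (by simp; omega)

/-- The fast Fourier transform evaluates at all powers of the root of unity: the second half of the
values at the powers of `root (e + 1)` differs from the first half in the sign of the odd part, as
`root (e + 1) ^ 2 ^ e = -1`. -/
theorem Computes.fft {root : ℕ → K} (hr : IsRootTower root) (e : ℕ) (xs : List K)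
    (hxs : xs.length = 2 ^ e) :
    Computes (HankelAlg.fft root e xs)
      ((List.range (2 ^ e)).map fun j => (listPoly xs).eval (root e ^ j)) (2 * e * 2 ^ e) := by
  induction e generalizing xs with
  | zero =>
    obtain ⟨a, rfl⟩ := List.length_eq_one_iff.mp (by simpa using hxs)
    simpa [HankelAlg.fft, listPoly] using Computes.pure _
  | succ e ih =>
    rw [HankelAlg.fft]
    have hu := ih (evens xs) (by rw [length_evens, hxs, pow_succ]; omega)
    have hv := ih (evens xs.tail) (by
      rw [length_evens, List.length_tail, hxs, pow_succ]
      have := Nat.one_le_two_pow (n := e)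
      omega)
    have hres : ((List.range (2 ^ (e + 1))).map fun j => (listPoly xs).eval (root (e + 1) ^ j)) =
        List.zipWith (· + ·)
          ((List.range (2 ^ e)).map fun j => (listPoly (evens xs)).eval (root e ^ j))
          (((List.range (2 ^ e)).map fun j => (listPoly (evens xs.tail)).eval (root e ^ j)).mapIdx
            fun i x => root (e + 1) ^ (0 + i) * x) ++
        List.zipWith (· - ·)
          ((List.range (2 ^ e)).map fun j => (listPoly (evens xs)).eval (root e ^ j))
          (((List.range (2 ^ e)).map fun j => (listPoly (evens xs.tail)).eval (root e ^ j)).mapIdx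
            fun i x => root (e + 1) ^ (0 + i) * x) := by
      have hsq : ∀ j, (root (e + 1) ^ j) ^ 2 = root e ^ j := fun j => by
        rw [← hr.sq e, ← pow_mul, ← pow_mul, mul_comm]
      have hper : root e ^ 2 ^ e = 1 := (hr.isPrimitiveRoot e).pow_eq_one
      rw [pow_succ, mul_two, List.range_add, List.map_append]
      congr 1
      · refine List.ext_getElem (by simp) fun i _ _ => ?_
        simp [eval_listPoly_evens _ xs, hsq]
      · refine List.ext_getElem (by simp) fun i _ _ => ?_
        simp only [List.getElem_map, List.getElem_zipWith, List.getElem_mapIdx,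
          List.getElem_range, eval_listPoly_evens _ xs, hsq, pow_add, hper, hr.pow_two_pow, one_mul,
          pow_zero]
        ring
    rw [hres]
    refine Computes.mono (.bind hu (.bind hv (.bind (.twiddle _ _ _) (.bind (.zipArith_add _ _)
      (.bind (.zipArith_sub _ _) (.pure _)))))) ?_
    simp only [List.length_map, List.length_range, pow_succ]
    exact le_of_eq (by ring)

/-- The coefficient list of the product of two polynomials given by coefficient lists. -/
noncomputable def mulList (a b : List K) : List K :=
  jet (a.length + b.length - 1) (ser a * ser b)

omit [DecidableEq K] in
@[simp]
theorem length_mulList (a b : List K) : (mulList a b).length = a.length + b.length - 1 := by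
  simp [mulList]

omit [DecidableEq K] in
theorem ser_mulList {a b : List K} (ha : a ≠ []) (hb : b ≠ []) :
    ser (mulList a b) = ser a * ser b := by
  have ha' := List.length_pos_iff.mpr ha
  have hb' := List.length_pos_iff.mpr hb
  ext i
  rcases lt_or_ge i (a.length + b.length - 1) with h | h
  · rw [mulList, coeff_ser_jet_of_lt _ h]
  · rw [coeff_ser_of_le (by simpa using h), PowerSeries.coeff_mul]
    refine (Finset.sum_eq_zero fun p hp => ?_).symm
    have hp' := Finset.HasAntidiagonal.mem_antidiagonal.mp hp
    rcases lt_or_ge p.1 a.length with h1 | h1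
    · rw [coeff_ser_of_le (l := b) (by omega), mul_zero]
    · rw [coeff_ser_of_le h1, zero_mul]

/-- An upper bound for the cost of multiplying two polynomials whose product is stored in a list of
at most `2 ^ e` coefficients: three transforms of length `2 ^ e`, each of cost `2 e 2 ^ e`, and
linearly many further operations. -/
def mulCost (e : ℕ) : ℕ := (6 * e + 4) * 2 ^ e

theorem mulCost_mono {e e' : ℕ} (h : e ≤ e') : mulCost e ≤ mulCost e' :=
  Nat.mul_le_mul (by omega) (Nat.pow_le_pow_right (by norm_num) h)

theorem Computes.mulFFT {root : ℕ → K} (hr : IsRootTower root) {a b : List K} (ha : a ≠ [])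
    (hb : b ≠ []) {e' : ℕ} (he' : a.length + b.length - 1 ≤ 2 ^ e') :
    Computes (HankelAlg.mulFFT root a b) (mulList a b) (mulCost e') := by
  have ha' := List.length_pos_iff.mpr ha
  have hb' := List.length_pos_iff.mpr hb
  set len := a.length + b.length - 1 with hlen
  set e := Nat.clog 2 len with he
  have hle : len ≤ 2 ^ e := Nat.le_pow_clog one_lt_two _
  have hee : e ≤ e' := Nat.clog_le_of_le_pow he'
  rw [HankelAlg.mulFFT]
  simp only [← hlen, ← he]
  have hu := Computes.fft hr e (a ++ List.replicate (2 ^ e - a.length) 0) (by simp; omega)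
  have hv := Computes.fft hr e (b ++ List.replicate (2 ^ e - b.length) 0) (by simp; omega)
  set p := jet (2 ^ e) (ser a * ser b) with hp
  -- the pointwise products are the values of the product polynomial
  have hvals : List.zipWith (· * ·)
      ((List.range (2 ^ e)).map fun j =>
        (listPoly (a ++ List.replicate (2 ^ e - a.length) 0)).eval (root e ^ j))
      ((List.range (2 ^ e)).map fun j =>
        (listPoly (b ++ List.replicate (2 ^ e - b.length) 0)).eval (root e ^ j)) =
      (List.range (2 ^ e)).map fun j => (listPoly p).eval (root e ^ j) := by
    have hpoly : listPoly p = listPoly (a ++ List.replicate (2 ^ e - a.length) 0) *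
        listPoly (b ++ List.replicate (2 ^ e - b.length) 0) := by
      apply Polynomial.coe_injective K
      rw [Polynomial.coe_mul]
      change ser p = ser _ * ser _
      rw [ser_append_replicate, ser_append_replicate, ← ser_mulList ha hb]
      ext i
      rcases lt_or_ge i (2 ^ e) with h | h
      · rw [hp, coeff_ser_jet_of_lt _ h, ser_mulList ha hb]
      · rw [coeff_ser_of_le (by simpa [hp] using h),
          coeff_ser_of_le (by rw [length_mulList]; omega)]
    simp [List.zipWith_map, List.zipWith_self, hpoly]
  have hq := Computes.fft hr.inv e ((List.range (2 ^ e)).map fun j =>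
    (listPoly p).eval (root e ^ j)) (by simp)
  -- the inverse transform recovers the coefficients, up to the factor `2 ^ e`
  have hinv : (((List.range (2 ^ e)).map fun k => (listPoly ((List.range (2 ^ e)).map fun j =>
      (listPoly p).eval (root e ^ j))).eval ((root e)⁻¹ ^ k)).take len).map
        (((2 : K) ^ e)⁻¹ * ·) = mulList a b := by
    refine eq_of_getD (by simp; omega) fun k hk => ?_
    simp only [List.length_map, List.length_take, List.length_range] at hk
    have hk1 : k < 2 ^ e := by omega
    have hk2 : k < len := by omega
    have hl : (mulList a b).getD k 0 = p.getD k 0 := by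
      rw [mulList, hp, getD_jet, getD_jet, if_pos hk1, if_pos hk2]
    rw [hl]
    have hs : (listPoly ((List.range (2 ^ e)).map fun j =>
        (listPoly p).eval (root e ^ j))).eval ((root e)⁻¹ ^ k) = 2 ^ e * p.getD k 0 := by
      have hlp : p.length = 2 ^ e := by simp [hp]
      rw [listPoly_eval_eq_sum, List.length_map, List.length_range]
      calc ∑ j ∈ Finset.range (2 ^ e), ((List.range (2 ^ e)).map fun j =>
              (listPoly p).eval (root e ^ j)).getD j 0 * ((root e)⁻¹ ^ k) ^ j
          = ∑ j ∈ Finset.range (2 ^ e), ∑ i ∈ Finset.range (2 ^ e),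
              p.getD i 0 * ((root e ^ j) ^ i * ((root e)⁻¹ ^ k) ^ j) := by
            refine Finset.sum_congr rfl fun j hj => ?_
            have hj' := Finset.mem_range.mp hj
            rw [List.getD_eq_getElem _ _ (by simpa using hj'), List.getElem_map,
              List.getElem_range, listPoly_eval_eq_sum, hlp, Finset.sum_mul]
            exact Finset.sum_congr rfl fun i _ => by ring
        _ = ∑ i ∈ Finset.range (2 ^ e), p.getD i 0 * if i = k then 2 ^ e else 0 := by
            rw [Finset.sum_comm]
            refine Finset.sum_congr rfl fun i hi => ?_
            rw [← Finset.mul_sum, hr.sum_pow_mul_inv_pow e (Finset.mem_range.mp hi) hk1]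
        _ = 2 ^ e * p.getD k 0 := by
            simp [hk1, mul_comm]
    rw [List.getD_eq_getElem _ _ (by simp; omega)]
    simp only [List.getElem_map, List.getElem_take, List.getElem_range]
    rw [hs, inv_mul_cancel_left₀ (pow_ne_zero _ hr.two_ne_zero)]
  rw [← hinv]
  have hp' := Computes.zipArith_mul
    ((List.range (2 ^ e)).map fun j =>
        (listPoly (a ++ List.replicate (2 ^ e - a.length) 0)).eval (root e ^ j))
    ((List.range (2 ^ e)).map fun j =>
        (listPoly (b ++ List.replicate (2 ^ e - b.length) 0)).eval (root e ^ j))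
  rw [hvals] at hp'
  refine Computes.mono (.bind (.const _) (.bind hu (.bind hv (.bind hp' (.bind hq
    (.bind (.const _) (.scale _ _))))))) (le_trans ?_ (mulCost_mono hee))
  have h1 := Nat.one_le_two_pow (n := e)
  have h2 : len ≤ 2 ^ e := hle
  simp only [List.length_map, List.length_range, List.length_take, mulCost]
  have h3 : (6 * e + 4) * 2 ^ e = 3 * (2 * e * 2 ^ e) + 4 * 2 ^ e := by ring
  omega

omit [DecidableEq K] in
theorem take_mulList_jet {l : List K} (hl : l ≠ []) (F : PowerSeries K) {j N : ℕ} (hj : j ≤ N) :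
    (mulList l (jet N F)).take j = jet j (ser l * F) := by
  have hl' := List.length_pos_iff.mpr hl
  rw [mulList, take_jet_of_le _ (by rw [length_jet]; omega)]
  exact jet_congr fun i hi => coeff_mul_congr (n := j) (fun _ _ => rfl)
    (fun i hi => coeff_ser_jet_of_lt F (by omega)) hi

omit [DecidableEq K] in
theorem take_jet_mulList {l : List K} (hl : l ≠ []) (F : PowerSeries K) {j N : ℕ} (hj : j ≤ N) :
    (mulList (jet N F) l).take j = jet j (F * ser l) := by
  rw [mul_comm F, ← take_mulList_jet hl F hj, mulList, mulList, mul_comm, add_comm]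

omit [DecidableEq K] in
theorem jet_ne_nil {n : ℕ} (hn : 0 < n) (F : PowerSeries K) : jet n F ≠ [] :=
  List.length_pos_iff.mp (by simpa using hn)

/-- An upper bound for the cost of inverting a power series to precision at most `2 ^ e`. The last
iteration costs at most half of this, so that the bound for `e - 1` fits into the other half. -/
def invCost (e : ℕ) : ℕ := (48 * e + 86) * 2 ^ e

open PowerSeries in
theorem Computes.invNewton {root : ℕ → K} (hr : IsRootTower root) {F : PowerSeries K}
    (hF : constantCoeff F ≠ 0) {N : ℕ} (e : ℕ) {n : ℕ} (h0 : 0 < n) (hn : n ≤ 2 ^ e)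
    (hN : n ≤ N) :
    Computes (HankelAlg.invNewton root n (jet N F)) (jet n F⁻¹) (invCost e) := by
  induction e generalizing n with
  | zero =>
    obtain rfl : n = 1 := by simp at hn; omega
    obtain ⟨N, rfl⟩ : ∃ k, N = k + 1 := ⟨N - 1, by omega⟩
    have hj : jet (N + 1) F = constantCoeff F :: (jet (N + 1) F).tail := by
      simp [jet, List.range_succ_eq_map]
    rw [HankelAlg.invNewton, dif_pos le_rfl, hj]
    simp only [zipArith]
    have h1 : jet 1 F⁻¹ = [1 / constantCoeff F] := by simp [jet]
    rw [h1]
    exact Computes.mono (.bind (.const _) (.bind (.div _ hF) (.bind (.pure _) (.pure _))))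
      (by simp [invCost])
  | succ e ih =>
    rcases Nat.lt_or_ge 1 n with h1 | h1
    swap
    · refine (ih h0 (h1.trans Nat.one_le_two_pow) hN).mono ?_
      exact Nat.mul_le_mul (by omega) (Nat.pow_le_pow_right (by norm_num) (by omega))
    rw [HankelAlg.invNewton, dif_neg (by omega)]
    set n' := (n + 1) / 2 with hn'
    set G := ser (jet n' F⁻¹) with hG
    have hg := ih (n := n') (by omega) (by rw [pow_succ] at hn; omega) (by omega)
    rw [take_jet_of_le _ hN]
    have hnil := jet_ne_nil (show 0 < n' by omega) F⁻¹
    have hp : Computes (HankelAlg.mulFFT root (jet n F) (jet n' F⁻¹)) _ (mulCost (e + 2)) :=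
      Computes.mulFFT hr (jet_ne_nil h0 _) hnil (by simp only [length_jet]; rw [pow_succ]; omega)
    have hpt : (mulList (jet n F) (jet n' F⁻¹)).take n = jet n (F * G) :=
      take_jet_mulList hnil F le_rfl
    have htwo : (2 : K) :: List.replicate (n - 1) 0 = jet n (2 : PowerSeries K) := by
      refine eq_of_getD (by simp; omega) fun i hi => ?_
      simp only [List.length_cons, List.length_replicate] at hi
      rw [getD_jet, if_pos (by omega)]
      have h2 : (2 : PowerSeries K) = C (2 : K) := (map_ofNat C 2).symm
      rw [h2, coeff_C]
      rcases i with _ | i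
      · simp
      · simp only [List.getD_cons_succ, Nat.succ_ne_zero, if_false]
        rw [List.getD_eq_getElem _ _ (by simp; omega), List.getElem_replicate]
    have hq := Computes.zipArith_sub (jet n (2 : PowerSeries K)) (jet n (F * G))
    rw [zipWith_sub_jet] at hq
    have hm : Computes (HankelAlg.mulFFT root (jet n' F⁻¹) (jet n (2 - F * G))) _
        (mulCost (e + 2)) :=
      Computes.mulFFT hr hnil (jet_ne_nil h0 _) (by simp only [length_jet]; rw [pow_succ]; omega)
    have hres : (mulList (jet n' F⁻¹) (jet n (2 - F * G))).take n = jet n F⁻¹ := by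
      rw [take_mulList_jet hnil _ le_rfl]
      -- the error of the approximation `G` is squared: `F⁻¹ - G (2 - F G) = F (G - F⁻¹)²`
      have hsq : G * (2 - F * G) = F⁻¹ - F * (G - F⁻¹) ^ 2 := by
        linear_combination (F⁻¹ - 2 * G) * PowerSeries.mul_inv_cancel F hF
      obtain ⟨E, hE⟩ : X ^ n' ∣ G - F⁻¹ := by
        rw [X_pow_dvd_iff]
        intro i hi
        rw [map_sub, hG, coeff_ser_jet_of_lt _ hi, sub_self]
      refine jet_congr fun i hi => ?_
      have hdvd : X ^ n ∣ F * (G - F⁻¹) ^ 2 := by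
        refine (pow_dvd_pow X (show n ≤ n' * 2 by omega)).trans ⟨F * E ^ 2, ?_⟩
        rw [hE]
        ring
      rw [hsq, map_sub, X_pow_dvd_iff.mp hdvd i hi, sub_zero]
    rw [← hres]
    refine Computes.mono (.bind hg (.bind hp (.bind (.const _) (.bind (.const _) (.bind
      (hpt ▸ htwo ▸ hq) (.bind hm (.pure _))))))) ?_
    simp only [List.length_cons, List.length_replicate, invCost, mulCost]
    have h3 : 1 ≤ 2 ^ e := Nat.one_le_two_pow
    have h4 : (48 * (e + 1) + 86) * 2 ^ (e + 1) = 96 * (e * 2 ^ e) + 268 * 2 ^ e := by ring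
    have h5 : (48 * e + 86) * 2 ^ e = 48 * (e * 2 ^ e) + 86 * 2 ^ e := by ring
    have h6 : (6 * (e + 2) + 4) * 2 ^ (e + 2) = 24 * (e * 2 ^ e) + 64 * 2 ^ e := by ring
    rw [pow_succ] at hn
    omega

end FFT
/-! ### Euclidean division of power series -/

section Euclid

open PowerSeries

variable {K : Type} [Field K]

/-- One division step on a pair `(F, G)` of power series with `F(0) ≠ 0` and `G(0) = 0`: here `m` is
the order of `G`, and the quotient, of formal degree `m`, is stored in the list `B`. If
`F = x ^ deg f * f (1 / x)` and `G = x ^ deg f * g (1 / x)` for polynomials `f` and `g`, the new pair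
arises in the same way from `g` and `B g - f`. -/
structure EuclidStep (F G : K⟦X⟧) (m : ℕ) (B : List K) (F' G' : K⟦X⟧) : Prop where
  pos : 1 ≤ m
  length_eq : B.length = m + 1
  eq_mul : G = X ^ m * F'
  mul_eq : X ^ m * G' = ser B * F' - F
  ne_zero : constantCoeff F' ≠ 0
  eq_zero : constantCoeff G' = 0

/-- `EuclidChain F G Bs s F' G'`: consecutive division steps with the quotients `Bs`, of total degree
`s`, lead from `(F, G)` to `(F', G')`. -/
inductive EuclidChain : K⟦X⟧ → K⟦X⟧ → List (List K) → ℕ → K⟦X⟧ → K⟦X⟧ → Prop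
  | nil (F G : K⟦X⟧) : EuclidChain F G [] 0 F G
  | cons {F G F₁ G₁ F₂ G₂ : K⟦X⟧} {m s : ℕ} {B : List K} {Bs : List (List K)} :
      EuclidStep F G m B F₁ G₁ → EuclidChain F₁ G₁ Bs s F₂ G₂ →
        EuclidChain F G (B :: Bs) (m + s) F₂ G₂

theorem EuclidChain.append {F G F₁ G₁ F₂ G₂ : K⟦X⟧} {s t : ℕ} {Bs Cs : List (List K)}
    (h : EuclidChain F G Bs s F₁ G₁) (h' : EuclidChain F₁ G₁ Cs t F₂ G₂) :
    EuclidChain F G (Bs ++ Cs) (s + t) F₂ G₂ := by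
  induction h with
  | nil => simpa using h'
  | cons hs _ ih =>
    rw [add_assoc]
    exact .cons hs (ih h')

theorem EuclidChain.constantCoeff_ne_and_eq {F G F' G' : K⟦X⟧} {s : ℕ} {Bs : List (List K)}
    (h : EuclidChain F G Bs s F' G') (hF : constantCoeff F ≠ 0) (hG : constantCoeff G = 0) :
    constantCoeff F' ≠ 0 ∧ constantCoeff G' = 0 := by
  induction h with
  | nil => exact ⟨hF, hG⟩
  | cons hs _ ih => exact ih hs.ne_zero hs.eq_zero

theorem exists_euclidStep {F G : K⟦X⟧} {m : ℕ} (hm : 1 ≤ m) (hlt : ∀ i < m, coeff i G = 0)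
    (hne : coeff m G ≠ 0) :
    ∃ F' G', EuclidStep F G m (jet (m + 1) (F * F'⁻¹)) F' G' := by
  obtain ⟨F', rfl⟩ : X ^ m ∣ G := X_pow_dvd_iff.mpr hlt
  have hF' : constantCoeff F' ≠ 0 := by
    simpa [coeff_X_pow_mul'] using hne
  have hdvd : X ^ (m + 1) ∣ ser (jet (m + 1) (F * F'⁻¹)) * F' - F := by
    rw [X_pow_dvd_iff]
    intro i hi
    have h : F = F * F'⁻¹ * F' := by rw [mul_assoc, PowerSeries.inv_mul_cancel _ hF', mul_one]
    rw [map_sub, sub_eq_zero]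
    conv_rhs => rw [h]
    exact coeff_mul_congr (n := m + 1) (fun i hi => coeff_ser_jet_of_lt _ hi) (fun _ _ => rfl) hi
  obtain ⟨E, hE⟩ := hdvd
  exact ⟨F', X * E, hm, by simp, rfl, by rw [hE]; ring, hF', by simp⟩

theorem EuclidStep.coeff_eq_zero_and_ne_zero {F G F' G' : K⟦X⟧} {m : ℕ} {B : List K}
    (hs : EuclidStep F G m B F' G') :
    (∀ i < m, coeff i G = 0) ∧ coeff m G ≠ 0 := by
  rw [hs.eq_mul]
  refine ⟨fun i hi => by rw [coeff_X_pow_mul', if_neg (by omega)], ?_⟩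
  rw [coeff_X_pow_mul', if_pos le_rfl, Nat.sub_self]
  simpa using hs.ne_zero

theorem EuclidStep.unique {F G F₁ G₁ F₂ G₂ : K⟦X⟧} {m₁ m₂ : ℕ} {B₁ B₂ : List K}
    (h₁ : EuclidStep F G m₁ B₁ F₁ G₁) (h₂ : EuclidStep F G m₂ B₂ F₂ G₂) :
    m₁ = m₂ ∧ B₁ = B₂ ∧ F₁ = F₂ ∧ G₁ = G₂ := by
  have hm : m₁ = m₂ := by
    rcases lt_trichotomy m₁ m₂ with h | h | h
    · exact absurd (h₂.coeff_eq_zero_and_ne_zero.1 _ h) h₁.coeff_eq_zero_and_ne_zero.2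
    · exact h
    · exact absurd (h₁.coeff_eq_zero_and_ne_zero.1 _ h) h₂.coeff_eq_zero_and_ne_zero.2
  subst hm
  have hX : (X : K⟦X⟧) ^ m₁ ≠ 0 := pow_ne_zero _ X_ne_zero
  have hF : F₁ = F₂ := mul_left_cancel₀ hX (h₁.eq_mul.symm.trans h₂.eq_mul)
  subst hF
  have hB : B₁ = B₂ := by
    refine eq_of_getD (h₁.length_eq.trans h₂.length_eq.symm) fun i hi => ?_
    obtain ⟨E, hE⟩ : X ∣ G₁ - G₂ :=
      X_dvd_iff.mpr (by rw [map_sub, h₁.eq_zero, h₂.eq_zero, sub_zero])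
    have hd : ser B₁ - ser B₂ = X ^ (m₁ + 1) * (E * F₁⁻¹) := by
      linear_combination (ser B₂ - ser B₁) * PowerSeries.mul_inv_cancel F₁ h₁.ne_zero -
        h₁.mul_eq * F₁⁻¹ + h₂.mul_eq * F₁⁻¹ + X ^ m₁ * F₁⁻¹ * hE
    have hc := congrArg (coeff i) hd
    rw [coeff_X_pow_mul', if_neg (by rw [h₁.length_eq] at hi; omega), map_sub, coeff_ser,
      coeff_ser] at hc
    exact sub_eq_zero.mp hc
  subst hB
  exact ⟨rfl, rfl, rfl, mul_left_cancel₀ hX (h₁.mul_eq.trans h₂.mul_eq.symm)⟩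

end Euclid

/-! ### The half-GCD algorithm -/

section HalfGCD

open PowerSeries

variable {K : Type} [Field K]

/-- The specification of the half-GCD algorithm on the pair `(F, G)` of power series: the quotients
of total degree `s ≤ k` lead to a pair `(F', G')`, the next quotient (if there is one) has degree
greater than `k - s`, and the matrix takes `(F, G)` to `x²ˢ (F', G')`. -/
structure HalfGCDSpec (k : ℕ) (F G F' G' : K⟦X⟧) (R : HalfGCD K) : Prop where
  chain : EuclidChain F G R.quots R.s F' G'
  le : R.s ≤ k
  coeff_eq_zero : ∀ i ≤ k - R.s, coeff i G' = 0
  length₁₁ : R.w₁₁.length = R.s + 1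
  length₁₂ : R.w₁₂.length = R.s + 1
  length₂₁ : R.w₂₁.length = R.s + 1
  length₂₂ : R.w₂₂.length = R.s + 1
  row₁ : ser R.w₁₁ * F + ser R.w₁₂ * G = X ^ (2 * R.s) * F'
  row₂ : ser R.w₂₁ * F + ser R.w₂₂ * G = X ^ (2 * R.s) * G'

/-- An upper bound for the cost of the half-GCD algorithm on input `k < 2 ^ a`. Outside the recursive
calls there are 16 products of length at most `2 ^ (a + 2)`, one inverse to precision at most `2 ^ a`
and linearly many further operations, together at most `1128 (a + 1) 2 ^ a`; as each of the `a` levels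
of the recursion repeats this bound, the square of `a + 1` appears. -/
def halfGCDCost (a : ℕ) : ℕ := 1128 * (a + 1) ^ 2 * 2 ^ a

theorem take_mulList_jet_jet (F G : K⟦X⟧) {j N N' : ℕ} (h0 : 0 < N) (hN : j ≤ N) (hN' : j ≤ N') :
    (mulList (jet N F) (jet N' G)).take j = jet j (F * G) := by
  rw [take_mulList_jet (jet_ne_nil h0 F) G hN']
  exact jet_congr fun i hi => coeff_mul_congr (n := j)
    (fun i hi => coeff_ser_jet_of_lt F (by omega)) (fun _ _ => rfl) hi

/-- The list of `a b + c d`. -/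
noncomputable def mulAddList (a b c d : List K) : List K :=
  List.zipWith (· + ·) (mulList a b) (mulList c d)

theorem length_mulAddList {a b c d : List K} {n : ℕ} (h : a.length + b.length - 1 = n)
    (h' : c.length + d.length - 1 = n) : (mulAddList a b c d).length = n := by
  simp [mulAddList, h, h']

theorem ser_mulAddList {a b c d : List K} (h : a.length + b.length = c.length + d.length)
    (ha : a ≠ []) (hb : b ≠ []) (hc : c ≠ []) (hd : d ≠ []) :
    ser (mulAddList a b c d) = ser a * ser b + ser c * ser d := by
  rw [mulAddList, ser_zipWith_add (by simp [h]), ser_mulList ha hb, ser_mulList hc hd]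

theorem take_mulAddList_jet {a c : List K} (ha : a ≠ []) (hc : c ≠ []) (F G : K⟦X⟧) (N : ℕ) :
    (mulAddList a (jet N F) c (jet N G)).take N = jet N (ser a * F + ser c * G) := by
  rw [mulAddList, List.take_zipWith, take_mulList_jet ha F le_rfl, take_mulList_jet hc G le_rfl]
  simp [jet, List.zipWith_map, List.zipWith_self]

variable [DecidableEq K]

theorem Computes.mulAdd {root : ℕ → K} (hr : IsRootTower root) {a b c d : List K} (ha : a ≠ [])
    (hb : b ≠ []) (hc : c ≠ []) (hd : d ≠ []) {e n : ℕ} (h : a.length + b.length - 1 = n)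
    (h' : c.length + d.length - 1 = n) (hn : n ≤ 2 ^ e) :
    Computes (HankelAlg.mulAdd root a b c d) (mulAddList a b c d) (2 * mulCost e + n) :=
  Computes.mono (.bind (.mulFFT hr ha hb (h.le.trans hn)) (.bind (.mulFFT hr hc hd (h'.le.trans hn))
    (.zipArith_add _ _))) (by rw [length_mulList, h]; omega)

theorem ne_nil_of_length {α : Type} {l : List α} {n : ℕ} (h : l.length = n + 1) : l ≠ [] :=
  List.length_pos_iff.mp (by omega)

set_option maxHeartbeats 1000000 in
/-- Correctness and cost of the half-GCD algorithm. The statement covers all power series, whence the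
recursive call on truncated lists is an instance for the same pair of series. -/
theorem exists_computes_halfGCD {root : ℕ → K} (hr : IsRootTower root) (a : ℕ) {k : ℕ}
    (hk : k < 2 ^ a) {F G : K⟦X⟧} (hF : constantCoeff F ≠ 0) (hG : constantCoeff G = 0) :
    ∃ R F' G', Computes (halfGCD root k (jet (2 * k + 1) F) (jet (2 * k + 1) G)) R
      (halfGCDCost a) ∧ HalfGCDSpec k F G F' G' R := by
  induction a generalizing k F G with
  | zero =>
    obtain rfl : k = 0 := by simpa using hk
    refine ⟨⟨[], 0, [1], [0], [0], [1]⟩, F, G, ?_, .nil _ _, le_rfl, ?_, rfl, rfl, rfl, rfl, ?_, ?_⟩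
    · rw [halfGCD, dif_pos rfl]
      exact Computes.mono (.bind (.const _) (.bind (.const _) (.pure _))) (by simp [halfGCDCost])
    · intro i hi
      obtain rfl : i = 0 := by simpa using hi
      simpa using hG
    · simp [ser, listPoly]
    · simp [ser, listPoly]
  | succ b ih =>
    rcases Nat.eq_zero_or_pos k with rfl | hk0
    · obtain ⟨R, F', G', hR, hs⟩ := ih (k := 0) (by positivity) hF hG
      refine ⟨R, F', G', hR.mono ?_, hs⟩
      exact Nat.mul_le_mul (Nat.mul_le_mul le_rfl (Nat.pow_le_pow_left (by omega) 2))
        (Nat.pow_le_pow_right (by norm_num) (by omega))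
    have hpow : 2 ^ (b + 1) = 2 * 2 ^ b := by ring
    have hpow' : 2 ^ (b + 1 + 2) = 8 * 2 ^ b := by ring
    obtain ⟨R, F₁, G₁, hR, hs⟩ := ih (k := k / 2) (by omega) hF hG
    have hF₁ := (hs.chain.constantCoeff_ne_and_eq hF hG).1
    have hG₁ := (hs.chain.constantCoeff_ne_and_eq hF hG).2
    have hle := hs.le
    set s := R.s with hsdef
    obtain ⟨t, ht⟩ : ∃ t, t = k - s := ⟨_, rfl⟩
    have hn₁₁ := ne_nil_of_length hs.length₁₁
    have hn₁₂ := ne_nil_of_length hs.length₁₂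
    have hn₂₁ := ne_nil_of_length hs.length₂₁
    have hn₂₂ := ne_nil_of_length hs.length₂₂
    rw [halfGCD, dif_neg hk0.ne', take_jet_of_le _ (by omega), take_jet_of_le _ (by omega)]
    have hc₁ : Computes (HankelAlg.mulAdd root R.w₁₁ (jet (2 * k + 1) F) R.w₁₂
        (jet (2 * k + 1) G)) _ (2 * mulCost (b + 1 + 2) + (2 * k + 1 + s)) :=
      Computes.mulAdd hr hn₁₁ (jet_ne_nil (by omega) _) hn₁₂ (jet_ne_nil (by omega) _)
        (by rw [hs.length₁₁, length_jet]; omega) (by rw [hs.length₁₂, length_jet]; omega)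
        (by omega)
    have hc₂ : Computes (HankelAlg.mulAdd root R.w₂₁ (jet (2 * k + 1) F) R.w₂₂
        (jet (2 * k + 1) G)) _ (2 * mulCost (b + 1 + 2) + (2 * k + 1 + s)) :=
      Computes.mulAdd hr hn₂₁ (jet_ne_nil (by omega) _) hn₂₂ (jet_ne_nil (by omega) _)
        (by rw [hs.length₂₁, length_jet]; omega) (by rw [hs.length₂₂, length_jet]; omega)
        (by omega)
    have hlF : ((mulAddList R.w₁₁ (jet (2 * k + 1) F) R.w₁₂ (jet (2 * k + 1) G)).take
        (2 * k + 1)).drop (2 * s) = jet (2 * t + 1) F₁ := by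
      rw [take_mulAddList_jet hn₁₁ hn₁₂, hs.row₁, drop_jet_X_pow_mul]
      congr 1
      omega
    have hlG : ((mulAddList R.w₂₁ (jet (2 * k + 1) F) R.w₂₂ (jet (2 * k + 1) G)).take
        (2 * k + 1)).drop (2 * s) = jet (2 * t + 1) G₁ := by
      rw [take_mulAddList_jet hn₂₁ hn₂₂, hs.row₂, drop_jet_X_pow_mul]
      congr 1
      omega
    have hlz : ((jet (2 * t + 1) G₁).take (k - s + 1)).drop 1 =
        (List.range t).map fun i => coeff (i + 1) G₁ := by
      rw [take_jet_of_le _ (by omega), ← ht, jet, List.range_succ_eq_map]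
      simp
    have hget : ∀ j < t, ((List.range t).map fun i => coeff (i + 1) G₁).getD j 0 =
        coeff (j + 1) G₁ := fun j hj => by simp [hj]
    have hcost : halfGCDCost (b + 1) = 2 * halfGCDCost b + 1128 * (b + 2) * 2 ^ (b + 1) +
        1128 * (b + 1) * 2 ^ (b + 1) := by
      simp only [halfGCDCost, pow_succ]
      ring
    have hM : mulCost (b + 1 + 2) = 48 * (b * 2 ^ b) + 176 * 2 ^ b := by
      simp only [mulCost, pow_succ]
      ring
    have hI : invCost (b + 1) = 96 * (b * 2 ^ b) + 268 * 2 ^ b := by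
      simp only [invCost, pow_succ]
      ring
    have hH : halfGCDCost (b + 1) = 2 * halfGCDCost b + 4512 * (b * 2 ^ b) + 6768 * 2 ^ b := by
      rw [hcost]
      ring
    have h1 := Nat.one_le_two_pow (n := b)
    rcases Computes.leadingZeros ((List.range t).map fun i => coeff (i + 1) G₁) with
      ⟨hz, h0⟩ | ⟨i, hi, hz, h0, hne⟩
    · -- the next quotient is absent or of too large a degree
      refine ⟨R, F₁, G₁, ?_, hs.chain, by omega, ?_, hs.length₁₁, hs.length₁₂, hs.length₂₁,
        hs.length₂₂, hs.row₁, hs.row₂⟩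
      · refine Computes.mono (.bind hR (.bind hc₁ (.bind hc₂ (.bind (a := none)
          (c := t) ?_ (.pure _))))) ?_
        · simp only [← hsdef, hlG, hlz]
          simpa using hz
        · omega
      · rintro (_ | i) hi
        · simpa using hG₁
        · rw [← hget i (by omega)]
          exact h0 i
    -- the next quotient has degree `m = i + 1`
    simp only [List.length_map, List.length_range] at hi
    obtain ⟨F₂, G₂, hstep⟩ := exists_euclidStep (F := F₁) (G := G₁) (m := i + 1) (by omega)
      (fun j hj => by
        rcases j with _ | j
        · simpa using hG₁
        · rw [← hget j (by omega)]
          exact h0 j (by omega))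
      (by rw [← hget i hi]; exact hne)
    set m := i + 1 with hm
    set B := jet (m + 1) (F₁ * F₂⁻¹) with hB
    -- maximality of the first call: with this quotient the degrees add up to more than `k / 2`
    have hhalf : k / 2 - s < m := by
      by_contra hcon
      exact hne ((hget i hi).trans (hs.coeff_eq_zero _ (by omega)))
    obtain ⟨T, F₃, G₃, hT, hs'⟩ := ih (k := k - (s + m)) (by omega) hstep.ne_zero hstep.eq_zero
    have hle' := hs'.le
    have hlF₂ : (jet (2 * t + 1) G₁).drop m = jet (2 * t + 1 - m) F₂ := by
      rw [hstep.eq_mul, drop_jet_X_pow_mul]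
    have hBnil : B ≠ [] := jet_ne_nil (by omega) _
    have hBlen : B.length = m + 1 := hstep.length_eq
    have hinv := Computes.invNewton hr hstep.ne_zero (b + 1) (n := m + 1) (N := m + 1) (by omega)
      (by omega) le_rfl
    have hB' : Computes (HankelAlg.mulFFT root (jet (m + 1) F₁) (jet (m + 1) F₂⁻¹)) _
        (mulCost (b + 1 + 2)) :=
      Computes.mulFFT hr (jet_ne_nil (by omega) _) (jet_ne_nil (by omega) _)
        (by simp only [length_jet]; omega)
    have hP : Computes (HankelAlg.mulFFT root B (jet (2 * t + 1 - m) F₂)) _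
        (mulCost (b + 1 + 2)) :=
      Computes.mulFFT hr hBnil (jet_ne_nil (by omega) _)
        (by simp only [length_jet, hBlen]; omega)
    have hG₂' := Computes.zipArith_sub ((mulList B (jet (2 * t + 1 - m) F₂)).take (2 * t + 1 - m))
      ((jet (2 * t + 1) F₁).take (2 * t + 1 - m))
    rw [take_mulList_jet hBnil _ le_rfl, take_jet_of_le _ (by omega), zipWith_sub_jet,
      ← hstep.mul_eq, length_jet] at hG₂'
    have hlG₂ : (jet (2 * t + 1 - m) (X ^ m * G₂)).drop m = jet (2 * t + 1 - m - m) G₂ :=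
      drop_jet_X_pow_mul _ _ _
    have hp₁ : Computes (HankelAlg.mulFFT root B R.w₂₁) _ (mulCost (b + 1 + 2)) :=
      Computes.mulFFT hr hBnil hn₂₁ (by rw [hBlen, hs.length₂₁]; omega)
    have hp₂ : Computes (HankelAlg.mulFFT root B R.w₂₂) _ (mulCost (b + 1 + 2)) :=
      Computes.mulFFT hr hBnil hn₂₂ (by rw [hBlen, hs.length₂₂]; omega)
    set shift : List K := List.replicate m 0 with hshift
    set u₁₁ := shift ++ R.w₂₁ with hu₁₁
    set u₁₂ := shift ++ R.w₂₂ with hu₁₂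
    set u₂₁ := List.zipWith (· - ·) (mulList B R.w₂₁) (shift ++ R.w₁₁) with hu₂₁
    set u₂₂ := List.zipWith (· - ·) (mulList B R.w₂₂) (shift ++ R.w₁₂) with hu₂₂
    have hl₁₁ : u₁₁.length = (s + m) + 1 := by simp [u₁₁, shift, hs.length₂₁]; omega
    have hl₁₂ : u₁₂.length = (s + m) + 1 := by simp [u₁₂, shift, hs.length₂₂]; omega
    have hl₂₁ : u₂₁.length = (s + m) + 1 := by
      simp [u₂₁, shift, hs.length₂₁, hs.length₁₁, hBlen]; omega
    have hl₂₂ : u₂₂.length = (s + m) + 1 := by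
      simp [u₂₂, shift, hs.length₂₂, hs.length₁₂, hBlen]; omega
    have hser₁₁ : ser u₁₁ = X ^ m * ser R.w₂₁ := ser_replicate_append _ _
    have hser₁₂ : ser u₁₂ = X ^ m * ser R.w₂₂ := ser_replicate_append _ _
    have hser₂₁ : ser u₂₁ = ser B * ser R.w₂₁ - X ^ m * ser R.w₁₁ := by
      rw [hu₂₁, ser_zipWith_sub (by simp [shift, hs.length₂₁, hs.length₁₁, hBlen]; omega),
        ser_mulList hBnil hn₂₁, ser_replicate_append]
    have hser₂₂ : ser u₂₂ = ser B * ser R.w₂₂ - X ^ m * ser R.w₁₂ := by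
      rw [hu₂₂, ser_zipWith_sub (by simp [shift, hs.length₂₂, hs.length₁₂, hBlen]; omega),
        ser_mulList hBnil hn₂₂, ser_replicate_append]
    have hu₁ : ser u₁₁ * F + ser u₁₂ * G = X ^ (2 * (s + m)) * F₂ := by
      rw [hser₁₁, hser₁₂]
      linear_combination X ^ m * hs.row₂ + X ^ m * X ^ (2 * s) * hstep.eq_mul
    have hu₂ : ser u₂₁ * F + ser u₂₂ * G = X ^ (2 * (s + m)) * G₂ := by
      rw [hser₂₁, hser₂₂]
      linear_combination ser B * hs.row₂ - X ^ m * hs.row₁ + ser B * X ^ (2 * s) * hstep.eq_mul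
        - X ^ m * X ^ (2 * s) * hstep.mul_eq
    have hm₁₁ := ne_nil_of_length hs'.length₁₁
    have hm₁₂ := ne_nil_of_length hs'.length₁₂
    have hm₂₁ := ne_nil_of_length hs'.length₂₁
    have hm₂₂ := ne_nil_of_length hs'.length₂₂
    have hv : ∀ {p q x y : List K}, p.length = T.s + 1 → q.length = T.s + 1 →
        x.length = s + m + 1 → y.length = s + m + 1 →
        Computes (HankelAlg.mulAdd root p x q y) (mulAddList p x q y)
          (2 * mulCost (b + 1 + 2) + (s + m + T.s + 1)) ∧
        (mulAddList p x q y).length = s + m + T.s + 1 ∧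
        ser (mulAddList p x q y) = ser p * ser x + ser q * ser y := by
      intro p q x y hp hq hx hy
      have h1 := ne_nil_of_length hp
      have h2 := ne_nil_of_length hq
      have h3 := ne_nil_of_length hx
      have h4 := ne_nil_of_length hy
      exact ⟨Computes.mulAdd hr h1 h3 h2 h4 (by omega) (by omega) (by omega),
        length_mulAddList (by omega) (by omega), ser_mulAddList (by omega) h1 h3 h2 h4⟩
    have hv₁₁ := hv hs'.length₁₁ hs'.length₁₂ hl₁₁ hl₂₁
    have hv₁₂ := hv hs'.length₁₁ hs'.length₁₂ hl₁₂ hl₂₂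
    have hv₂₁ := hv hs'.length₂₁ hs'.length₂₂ hl₁₁ hl₂₁
    have hv₂₂ := hv hs'.length₂₁ hs'.length₂₂ hl₁₂ hl₂₂
    refine ⟨⟨R.quots ++ B :: T.quots, s + m + T.s, mulAddList T.w₁₁ u₁₁ T.w₁₂ u₂₁,
      mulAddList T.w₁₁ u₁₂ T.w₁₂ u₂₂, mulAddList T.w₂₁ u₁₁ T.w₂₂ u₂₁,
      mulAddList T.w₂₁ u₁₂ T.w₂₂ u₂₂⟩, F₃, G₃, ?_, ?_, ?_, ?_, hv₁₁.2.1, hv₁₂.2.1, hv₂₁.2.1,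
      hv₂₂.2.1, ?_, ?_⟩
    · refine Computes.mono (.bind hR (.bind hc₁ (.bind hc₂ (.bind (a := some i)
        (c := t) (c' := invCost (b + 1) + (mulCost (b + 1 + 2) + (8 * mulCost (b + 1 + 2) +
          4 * (s + m + T.s + 1) + halfGCDCost b + 2 * (s + m + 1) + 3 * mulCost (b + 1 + 2) +
          (2 * t + 1 - m) + 1))) ?_ ?_)))) ?_
      · simp only [← hsdef, hlG, hlz]
        simpa using hz
      · simp only [← hsdef, hlG, hlF, ← hm, hlF₂, length_jet]
        rw [take_jet_of_le F₂ (by omega), take_jet_of_le F₁ (by omega)]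
        refine .bind hinv (.bind hB' ?_)
        rw [take_mulList_jet_jet _ _ (by omega) le_rfl le_rfl, ← hB]
        refine Computes.mono (.bind hP (.bind (a := jet (2 * t + 1 - m) (X ^ m * G₂))
          (c := 2 * t + 1 - m) ?_ (.bind (.const _) (.bind hp₁ (.bind hp₂
          (.bind (.zipArith_sub _ _) (.bind (.zipArith_sub _ _) (.bind (a := T)
          (c := halfGCDCost b) ?_ (.bind hv₁₁.1
          (.bind hv₁₂.1 (.bind hv₂₁.1 (.bind hv₂₂.1 (.pure _))))))))))))) ?_
        · rw [take_mulList_jet hBnil _ le_rfl, take_jet_of_le _ (by omega)]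
          exact hG₂'
        · rw [hlG₂, take_jet_of_le _ (by omega), take_jet_of_le _ (by omega)]
          exact hT
        · simp only [length_mulList, hBlen, hs.length₂₁, hs.length₂₂]
          omega
      · omega
    · rw [add_assoc]
      exact hs.chain.append (.cons hstep hs'.chain)
    · simp only
      omega
    · intro j hj
      exact hs'.coeff_eq_zero j (by simp only at hj; omega)
    · simp only [hv₁₁.2.2, hv₁₂.2.2]
      linear_combination hs'.row₁ * X ^ (2 * (s + m)) + ser T.w₁₁ * hu₁ + ser T.w₁₂ * hu₂
    · simp only [hv₂₁.2.2, hv₂₂.2.2]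
      linear_combination hs'.row₂ * X ^ (2 * (s + m)) + ser T.w₂₁ * hu₁ + ser T.w₂₂ * hu₂

end HalfGCD
/-! ### Hankel determinants of continued fractions -/

section Hankel

open PowerSeries

variable {K : Type} [Field K]

/-- The determinant of a matrix that vanishes above the antidiagonal and is constant on it. -/
theorem det_of_antitriangular {m : ℕ} {b : K} (A : Matrix (Fin m) (Fin m) K)
    (h0 : ∀ i j : Fin m, (i : ℕ) + j + 1 < m → A i j = 0)
    (hb : ∀ i j : Fin m, (i : ℕ) + j + 1 = m → A i j = b) :
    A.det = (-1) ^ (m * (m - 1) / 2) * b ^ m := by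
  induction m with
  | zero => simp
  | succ m ih =>
    rw [Matrix.det_succ_row_zero, Finset.sum_eq_single (Fin.last m)]
    · rw [ih (A.submatrix Fin.succ (Fin.last m).succAbove), hb 0 (Fin.last m) (by simp)]
      · have h : (m + 1) * (m + 1 - 1) / 2 = m + m * (m - 1) / 2 := by
          rcases m with _ | m
          · rfl
          · rw [add_comm (m + 1) ((m + 1) * _ / 2), ← Nat.add_mul_div_left _ _ two_pos]
            simp only [Nat.add_sub_cancel]
            congr 1
            ring
        rw [h, pow_add, Fin.val_last]
        ring
      · intro i j hij
        exact h0 _ _ (by simp; omega)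
      · intro i j hij
        exact hb _ _ (by simp; omega)
    · intro j _ hj
      have hj' : (j : ℕ) ≠ m := fun h => hj (Fin.ext (by simpa using h))
      rw [h0 0 j (by simp; omega)]
      simp
    · simp

/-- The generating function `∑ h_{i + j} xⁱ yʲ` of the infinite Hankel matrix of `h`. In the ring
`K⟦X⟧⟦X⟧` the inner variable is `x = C X` and the outer one is `y = X`. -/
noncomputable def hankelSeries (h : K⟦X⟧) : K⟦X⟧⟦X⟧ :=
  mk fun j => mk fun i => coeff (i + j) h

/-- The leading `n × n` block of the coefficient matrix of a series in two variables. -/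
noncomputable def coeffMatrix (n : ℕ) (A : K⟦X⟧⟦X⟧) : Matrix (Fin n) (Fin n) K :=
  Matrix.of fun i j => coeff (i : ℕ) (coeff (j : ℕ) A)

/-- The lower triangular Toeplitz matrix of a power series. -/
noncomputable def toeplitz (n : ℕ) (w : K⟦X⟧) : Matrix (Fin n) (Fin n) K :=
  Matrix.of fun i k => if k ≤ i then coeff ((i : ℕ) - k) w else 0

theorem det_coeffMatrix_hankelSeries (h : K⟦X⟧) (n : ℕ) :
    (coeffMatrix n (hankelSeries h)).det = hankelDet h n := by
  rw [hankelDet]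
  congr 1
  ext i j
  simp [coeffMatrix, hankelSeries]

theorem det_toeplitz (n : ℕ) (w : K⟦X⟧) : (toeplitz n w).det = constantCoeff w ^ n := by
  rw [Matrix.det_of_isLowerTriangular]
  · simp [toeplitz]
  · intro i j hij
    have hij' : i < j := by simpa using hij
    simp [toeplitz, not_le.mpr hij']

theorem sum_toeplitz {n : ℕ} (w f : K⟦X⟧) (i : Fin n) :
    ∑ k : Fin n, toeplitz n w i k * coeff (k : ℕ) f = coeff (i : ℕ) (w * f) := by
  rw [mul_comm w f, coeff_mul, Finset.Nat.sum_antidiagonal_eq_sum_range_succ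
    (fun a b => coeff a f * coeff b w)]
  have h : ∀ k : Fin n, toeplitz n w i k * coeff (k : ℕ) f =
      (fun k : ℕ => if k ≤ (i : ℕ) then coeff ((i : ℕ) - k) w * coeff k f else 0) k := fun k => by
    rw [toeplitz, Matrix.of_apply, ite_mul, zero_mul]
    rfl
  rw [Finset.sum_congr rfl fun k _ => h k, Fin.sum_univ_eq_sum_range
    (fun k : ℕ => if k ≤ (i : ℕ) then coeff ((i : ℕ) - k) w * coeff k f else 0), ← Finset.sum_filter]
  refine Finset.sum_congr ?_ fun k _ => mul_comm _ _
  ext k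
  simp only [Finset.mem_filter, Finset.mem_range]
  omega

theorem coeffMatrix_C_mul (n : ℕ) (w : K⟦X⟧) (A : K⟦X⟧⟦X⟧) :
    coeffMatrix n (C w * A) = toeplitz n w * coeffMatrix n A := by
  ext i j
  rw [Matrix.mul_apply]
  simp only [coeffMatrix, Matrix.of_apply, coeff_C_mul]
  exact (sum_toeplitz w _ i).symm

theorem coeffMatrix_map_C_mul (n : ℕ) (w : K⟦X⟧) (A : K⟦X⟧⟦X⟧) :
    coeffMatrix n (map C w * A) = coeffMatrix n A * (toeplitz n w).transpose := by
  ext i j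
  rw [Matrix.mul_apply]
  have h := sum_toeplitz w (mk fun k => coeff (i : ℕ) (coeff k A)) j
  simp only [coeff_mk] at h
  simp only [coeffMatrix, Matrix.of_apply, Matrix.transpose_apply]
  rw [Finset.sum_congr rfl fun k _ => mul_comm _ _, h, coeff_mul, coeff_mul, map_sum]
  simp

theorem det_coeffMatrix_mul (n : ℕ) (w : K⟦X⟧) (A : K⟦X⟧⟦X⟧) :
    (coeffMatrix n (C w * (map C w * A))).det =
      constantCoeff w ^ (2 * n) * (coeffMatrix n A).det := by
  rw [coeffMatrix_C_mul, coeffMatrix_map_C_mul, Matrix.det_mul, Matrix.det_mul,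
    Matrix.det_transpose, det_toeplitz]
  ring

/-- The displacement equation `(x - y) ∑ h_{i + j} xⁱ yʲ = x h(x) - y h(y)`. -/
theorem sub_mul_hankelSeries (h : K⟦X⟧) :
    (C X - X) * hankelSeries h = C (X * h) - map C (X * h) := by
  ext j i
  rw [sub_mul, map_sub, map_sub, map_sub, map_sub, coeff_C_mul, coeff_map, coeff_C]
  rcases i with _ | i <;> rcases j with _ | j <;>
    simp [hankelSeries, coeff_succ_X_mul, coeff_C, add_assoc, add_comm 1]

/-- The quotient `(x ^ m B(y) - y ^ m B(x)) / (x - y)` for a polynomial `B` of degree at most `m`. -/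
noncomputable def bezoutSeries (m : ℕ) (B : K⟦X⟧) : K⟦X⟧⟦X⟧ :=
  mk fun j => mk fun i => if i < m ∧ j < m ∧ m ≤ i + j + 1 then coeff (i + j + 1 - m) B else 0

theorem coeff_bezoutSeries (m : ℕ) (B : K⟦X⟧) (i j : ℕ) :
    coeff i (coeff j (bezoutSeries m B)) =
      if i < m ∧ j < m ∧ m ≤ i + j + 1 then coeff (i + j + 1 - m) B else 0 := by
  simp [bezoutSeries]

theorem sub_mul_bezoutSeries {m : ℕ} {B : K⟦X⟧} (hB : ∀ i, m < i → coeff i B = 0) :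
    (C X - X) * bezoutSeries m B = C (X ^ m) * map C B - X ^ m * C B := by
  ext j i
  have h1 : coeff i (coeff j (C (X ^ m) * map C B : K⟦X⟧⟦X⟧)) =
      if i = m then coeff j B else 0 := by
    rw [coeff_C_mul, coeff_map, mul_comm, coeff_C_mul, coeff_X_pow]
    simp
  have h2 : coeff i (coeff j (X ^ m * C B : K⟦X⟧⟦X⟧)) = if j = m then coeff i B else 0 := by
    rw [mul_comm, coeff_C_mul, coeff_X_pow]
    split_ifs <;> simp
  rw [sub_mul, map_sub, map_sub, map_sub, map_sub, h1, h2, coeff_C_mul]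
  have h3 : coeff i (X * coeff j (bezoutSeries m B)) =
      if 1 ≤ i ∧ i ≤ m ∧ j < m ∧ m ≤ i + j then coeff (i + j - m) B else 0 := by
    rcases i with _ | i
    · simp
    · rw [coeff_succ_X_mul, coeff_bezoutSeries]
      refine if_congr (by omega) ?_ rfl
      congr 2
      omega
  have h4 : coeff i (coeff j (X * bezoutSeries m B)) =
      if 1 ≤ j ∧ j ≤ m ∧ i < m ∧ m ≤ i + j then coeff (i + j - m) B else 0 := by
    rcases j with _ | j
    · simp
    · rw [coeff_succ_X_mul, coeff_bezoutSeries]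
      refine if_congr (by omega) ?_ rfl
      congr 2
  rw [h3, h4]
  rcases lt_trichotomy i m with hi | rfl | hi
  · rcases lt_trichotomy j m with hj | rfl | hj
    · rw [if_neg hi.ne, if_neg hj.ne, sub_self, sub_eq_zero]
      exact if_congr (by omega) rfl rfl
    · rw [if_neg hi.ne, if_pos rfl, if_neg (by omega), if_pos (by omega), Nat.add_sub_cancel]
    · rw [if_neg hi.ne, if_neg hj.ne', if_neg (by omega), if_neg (by omega)]
  · rcases lt_trichotomy j i with hj | rfl | hj
    · rw [if_pos rfl, if_neg hj.ne, if_neg (by omega : ¬(1 ≤ j ∧ j ≤ i ∧ i < i ∧ i ≤ i + j)),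
        sub_zero, sub_zero]
      by_cases hi : 1 ≤ i
      · rw [if_pos (by omega), Nat.add_sub_cancel_left]
      · omega
    · rw [sub_self, sub_self]
    · rw [if_pos rfl, if_neg hj.ne', if_neg (by omega), if_neg (by omega), hB _ hj]
  · rcases eq_or_ne j m with rfl | hj
    · rw [if_neg hi.ne', if_pos rfl, if_neg (by omega), if_neg (by omega), hB _ hi]
    · rw [if_neg hi.ne', if_neg hj, if_neg (by omega), if_neg (by omega)]

/-- If `x h(x) = x ^ m / w(x)` with `w(x) = B(x) - x ^ m * x h'(x)`, multiplying the generating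
function of the Hankel matrix of `h` by `w(x) w(y)` makes the matrix block diagonal, the second
block being the Hankel matrix of `h'`. -/
theorem mul_hankelSeries {m : ℕ} {B h h' : K⟦X⟧} (hB : ∀ i, m < i → coeff i B = 0)
    (hh : X * h * (B - X ^ m * (X * h')) = X ^ m) :
    C (B - X ^ m * (X * h')) * (map C (B - X ^ m * (X * h')) * hankelSeries h) =
      bezoutSeries m B + C (X ^ m) * (X ^ m * hankelSeries h') := by
  have hne : (C X - X : K⟦X⟧⟦X⟧) ≠ 0 := by
    intro h0
    have h1 := congrArg (fun A => coeff 1 (coeff 0 A)) h0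
    simp at h1
  -- both sides are compared after multiplication by the non-zero-divisor `x - y`
  refine mul_left_cancel₀ hne ?_
  set w := B - X ^ m * (X * h') with hw
  have hx : (C (X * h) * C w : K⟦X⟧⟦X⟧) = C (X ^ m) := by rw [← map_mul, hh]
  have hy : (map C (X * h) * map C w : K⟦X⟧⟦X⟧) = X ^ m := by rw [← map_mul, hh]; simp
  have hwx : (C w : K⟦X⟧⟦X⟧) = C B - C (X ^ m) * C (X * h') := by rw [hw, map_sub, map_mul]
  have hwy : (map C w : K⟦X⟧⟦X⟧) = map C B - X ^ m * map C (X * h') := by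
    rw [hw, map_sub, map_mul]; simp
  calc (C X - X) * (C w * (map C w * hankelSeries h))
      = C w * map C w * ((C X - X) * hankelSeries h) := by ring
    _ = C (X ^ m) * map C w - X ^ m * C w := by
        rw [sub_mul_hankelSeries]
        linear_combination map C w * hx - C w * hy
    _ = (C (X ^ m) * map C B - X ^ m * C B) +
          C (X ^ m) * X ^ m * (C (X * h') - map C (X * h')) := by
        rw [hwx, hwy]
        ring
    _ = (C X - X) * (bezoutSeries m B + C (X ^ m) * (X ^ m * hankelSeries h')) := by
        rw [← sub_mul_bezoutSeries hB, ← sub_mul_hankelSeries]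
        ring

theorem det_coeffMatrix_bezoutSeries (m : ℕ) (B : K⟦X⟧) :
    (coeffMatrix m (bezoutSeries m B)).det =
      (-1) ^ (m * (m - 1) / 2) * constantCoeff B ^ m := by
  refine det_of_antitriangular _ (fun i j hij => ?_) fun i j hij => ?_
  · rw [coeffMatrix, Matrix.of_apply, coeff_bezoutSeries, if_neg (by omega)]
  · rw [coeffMatrix, Matrix.of_apply, coeff_bezoutSeries, if_pos (by omega), hij]
    simp

theorem det_coeffMatrix_bezoutSeries_add (m t : ℕ) (B h : K⟦X⟧) :
    (coeffMatrix (m + t) (bezoutSeries m B + C (X ^ m) * (X ^ m * hankelSeries h))).det =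
      (-1) ^ (m * (m - 1) / 2) * constantCoeff B ^ m * hankelDet h t := by
  have hc : ∀ i j, coeff i (coeff j (C (X ^ m) * (X ^ m * hankelSeries h))) =
      if m ≤ i ∧ m ≤ j then coeff (i - m + (j - m)) h else 0 := by
    intro i j
    rw [coeff_C_mul, coeff_X_pow_mul', coeff_X_pow_mul']
    by_cases hi : m ≤ i <;> by_cases hj : m ≤ j <;> simp [hi, hj, hankelSeries]
  have hblock : (coeffMatrix (m + t)
      (bezoutSeries m B + C (X ^ m) * (X ^ m * hankelSeries h))).submatrix
        finSumFinEquiv finSumFinEquiv =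
      Matrix.fromBlocks (coeffMatrix m (bezoutSeries m B)) 0 0
        (coeffMatrix t (hankelSeries h)) := by
    ext i j
    rcases i with i | i <;> rcases j with j | j <;>
      simp [coeffMatrix, hc, coeff_bezoutSeries, -map_pow, -coeff_C_mul]
    simp [hankelSeries]
  rw [← Matrix.det_submatrix_equiv_self finSumFinEquiv, hblock, Matrix.det_fromBlocks_zero₂₁,
    det_coeffMatrix_bezoutSeries, det_coeffMatrix_hankelSeries]

/-- The effect of one continued fraction step on Hankel determinants: both sides are the determinant
of the leading block of order `m + t` of the two descriptions in `mul_hankelSeries`. -/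
theorem hankelDet_add {m : ℕ} {B h h' : K⟦X⟧} (hB : ∀ i, m < i → coeff i B = 0)
    (hh : X * h * (B - X ^ m * (X * h')) = X ^ m) (t : ℕ) :
    constantCoeff B ^ (2 * (m + t)) * hankelDet h (m + t) =
      (-1) ^ (m * (m - 1) / 2) * constantCoeff B ^ m * hankelDet h' t := by
  have hw : constantCoeff (B - X ^ m * (X * h')) = constantCoeff B := by
    simp
  rw [← det_coeffMatrix_bezoutSeries_add, ← mul_hankelSeries hB hh, det_coeffMatrix_mul, hw,
    det_coeffMatrix_hankelSeries]

theorem hankelDet_eq_zero_of_coeff {h : K⟦X⟧} {t : ℕ} (ht : 0 < t)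
    (h0 : ∀ i < t, coeff i h = 0) : hankelDet h t = 0 :=
  Matrix.det_eq_zero_of_row_eq_zero ⟨0, ht⟩ fun j => by simp [h0 j j.2]

theorem EuclidStep.constantCoeff_ne_zero {F G F' G' : K⟦X⟧} {m : ℕ} {B : List K}
    (hs : EuclidStep F G m B F' G') (hF : constantCoeff F ≠ 0) : constantCoeff (ser B) ≠ 0 := by
  have hm := hs.pos
  have h := congrArg constantCoeff hs.mul_eq
  rw [map_mul, map_sub, map_mul, map_pow, constantCoeff_X, zero_pow (by omega), zero_mul] at h
  intro h0
  rw [h0, zero_mul, zero_sub] at h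
  exact hF (neg_eq_zero.mp h.symm)

/-- After one division step the quotient `x h = G / F` becomes `x h' = G' / F'`, the two being
related by `x h = x ^ m / (B - x ^ m * x h')`. Since `h` starts with `m - 1` zeros, its Hankel
determinants of orders below `m` vanish, and the others come from those of `h'`. -/
theorem EuclidStep.exists_series {F G F' G' h : K⟦X⟧} {m : ℕ} {B : List K}
    (hs : EuclidStep F G m B F' G') (hF : constantCoeff F ≠ 0) (hh : X * h * F = G) :
    ∃ h' : K⟦X⟧, X * h' * F' = G' ∧
      (∀ t, 0 < t → t < m → hankelDet h t = 0) ∧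
      ∀ t, hankelDet h (m + t) = (-1) ^ (m * (m - 1) / 2) * (constantCoeff (ser B))⁻¹ ^ m *
        ((constantCoeff (ser B))⁻¹ ^ 2) ^ t * hankelDet h' t := by
  have hb := hs.constantCoeff_ne_zero hF
  obtain ⟨E, hE⟩ : X ∣ G' := X_dvd_iff.mpr hs.eq_zero
  have hh' : X * (E * F'⁻¹) * F' = G' := by
    rw [hE]
    linear_combination X * E * PowerSeries.inv_mul_cancel F' hs.ne_zero
  have hF' : F' ≠ 0 := fun h0 => hs.ne_zero (by rw [h0, map_zero])
  have hrel : X * h * (ser B - X ^ m * (X * (E * F'⁻¹))) = X ^ m := by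
    refine mul_right_cancel₀ hF' ?_
    linear_combination hh + hs.eq_mul - X * h * X ^ m * hh' - X * h * hs.mul_eq
  refine ⟨E * F'⁻¹, hh', fun t ht htm => ?_, fun t => ?_⟩
  · refine hankelDet_eq_zero_of_coeff ht fun i hi => ?_
    have hXh : X * h = X ^ m * (F' * F⁻¹) := by
      calc X * h = X * h * F * F⁻¹ := by
            rw [mul_assoc, mul_assoc, PowerSeries.mul_inv_cancel F hF, mul_one]
        _ = _ := by rw [hh, hs.eq_mul, mul_assoc]
    rw [← coeff_succ_X_mul, hXh, coeff_X_pow_mul', if_neg (by omega)]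
  · have hB : ∀ i, m < i → coeff i (ser B) = 0 := fun i hi =>
      coeff_ser_of_le (by rw [hs.length_eq]; omega)
    have h := hankelDet_add hB hrel t
    set b := constantCoeff (ser B)
    have hpow : b ^ (2 * (m + t)) ≠ 0 := pow_ne_zero _ hb
    refine mul_left_cancel₀ hpow (h.trans ?_)
    have h1 : b ^ (2 * (m + t)) = b ^ m * b ^ m * (b ^ 2) ^ t := by ring
    have h2 : b ^ m * b⁻¹ ^ m = 1 := by rw [← mul_pow, mul_inv_cancel₀ hb, one_pow]
    have h3 : (b ^ 2) ^ t * (b⁻¹ ^ 2) ^ t = 1 := by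
      rw [← mul_pow, ← mul_pow, mul_inv_cancel₀ hb, one_pow, one_pow]
    rw [h1]
    generalize (b ^ 2) ^ t = x at *
    generalize (b⁻¹ ^ 2) ^ t = y at *
    generalize b ^ m = u at *
    generalize b⁻¹ ^ m = v at *
    linear_combination -((-1) ^ (m * (m - 1) / 2) * u * hankelDet (E * F'⁻¹) t) *
      (x * y * h2 + h3)

/-- A Hankel determinant vanishes together with the one it becomes in a chain of division steps. -/
theorem EuclidChain.hankelDet_eq_zero {F G F' G' h : K⟦X⟧} {s : ℕ} {Bs : List (List K)}
    (hc : EuclidChain F G Bs s F' G') (hF : constantCoeff F ≠ 0) (hh : X * h * F = G)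
    {r t : ℕ} (hr : ∀ i ≤ r, coeff i G' = 0) (ht : 0 < t) (htr : t ≤ r) :
    hankelDet h (s + t) = 0 := by
  induction hc generalizing h with
  | nil F G =>
    rw [zero_add]
    refine hankelDet_eq_zero_of_coeff ht fun i hi => ?_
    obtain ⟨E, rfl⟩ : X ^ (r + 1) ∣ G := X_pow_dvd_iff.mpr fun i hi => hr i (by omega)
    have hXh : X * h = X ^ (r + 1) * (E * F⁻¹) := by
      calc X * h = X * h * F * F⁻¹ := by
            rw [mul_assoc, mul_assoc, PowerSeries.mul_inv_cancel F hF, mul_one]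
        _ = _ := by rw [hh, mul_assoc]
    rw [← coeff_succ_X_mul, hXh, coeff_X_pow_mul', if_neg (by omega)]
  | cons hs _ ih =>
    obtain ⟨h', hh', -, hd⟩ := hs.exists_series hF hh
    rw [add_assoc, hd, ih hs.ne_zero hh' hr, mul_zero]

variable [DecidableEq K]

/-- The recursion for the Hankel determinants, run on the quotients of a chain of division steps. As
the factors contributed by earlier quotients have been multiplied into `H` and `c`, the entries are
`H c⁻ᵗ` times the Hankel determinants belonging to the current pair `(F, G)`. -/
theorem EuclidChain.computes_hankelRec {F G F' G' h : K⟦X⟧} {s : ℕ} {Bs : List (List K)}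
    (hc : EuclidChain F G Bs s F' G') (hF : constantCoeff F ≠ 0) (hh : X * h * F = G)
    (H : K) {c : K} (hc0 : c ≠ 0) :
    Computes (hankelRec 0 Bs H c)
      ((List.range s).map fun i => H * c⁻¹ ^ (i + 1) * hankelDet h (i + 1)) (7 * s) := by
  induction hc generalizing h H c with
  | nil F G => simpa [hankelRec] using Computes.pure _
  | @cons F G F₁ G₁ F₂ G₂ m s B Bs hs _ ih =>
    obtain ⟨h', hh', h0, hd⟩ := hs.exists_series hF hh
    have hb := hs.constantCoeff_ne_zero hF
    obtain ⟨b, B, rfl⟩ : ∃ b B', B = b :: B' :=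
      List.exists_cons_of_ne_nil (ne_nil_of_length hs.length_eq)
    have hlen : B.length = m := by simpa using hs.length_eq
    have hcb : constantCoeff (ser (b :: B)) = b := by
      rw [← coeff_zero_eq_constantCoeff_apply, coeff_ser]
      rfl
    rw [hcb] at hb hd
    have hm := hs.pos
    set H'' := (-1) ^ (m * (m - 1) / 2) * (H / (c * b) ^ m) with hH''
    have hrec := ih hs.ne_zero hh' H'' (c := c * b * b) (by positivity)
    have hres : ((List.range (m + s)).map fun i => H * c⁻¹ ^ (i + 1) * hankelDet h (i + 1)) =
        List.replicate (m - 1) 0 ++ H'' ::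
          ((List.range s).map fun i => H'' * (c * b * b)⁻¹ ^ (i + 1) * hankelDet h' (i + 1)) := by
      obtain ⟨m, rfl⟩ : ∃ k, m = k + 1 := ⟨m - 1, by omega⟩
      rw [List.range_add, List.map_append, List.range_succ, List.map_append, List.append_assoc,
        Nat.add_sub_cancel, List.map_map]
      congr 1
      · refine List.ext_getElem (by simp) fun i h1 h2 => ?_
        simp only [List.length_map, List.length_range] at h1
        simp [h0 (i + 1) (by omega) (by omega)]
      · have h1 := hd 0
        have h2 : hankelDet h' 0 = 1 := by simp [hankelDet]
        simp only [add_zero, pow_zero, mul_one, h2] at h1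
        simp only [List.map_cons, List.map_nil, List.singleton_append, List.cons.injEq]
        constructor
        · rw [h1, hH'', div_eq_mul_inv, mul_pow, mul_inv, ← inv_pow, ← inv_pow]
          ring
        · refine List.map_congr_left fun i _ => ?_
          simp only [Function.comp_apply]
          rw [show m + 1 + i + 1 = m + 1 + (i + 1) by ring, hd (i + 1), hH'', div_eq_mul_inv,
            mul_pow, mul_inv, mul_inv, mul_inv, ← inv_pow, ← inv_pow]
          ring
    rw [hres, hankelRec, hlen]
    have hq : (c * b) ^ m ≠ 0 := by positivity
    refine Computes.mono (.bind (.mul c b) (.bind (.power (c * b) m) (.bind (.div H hq)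
      (.bind (a := H'') (c := 1) ?_ (.bind (.mul _ _) (.bind hrec (.pure _))))))) (by omega)
    rcases Nat.mod_two_eq_zero_or_one (m * (m - 1) / 2) with h2 | h2
    · rw [if_neg (by omega), hH'', (Nat.even_iff.mpr h2).neg_one_pow, one_mul]
      exact (Computes.pure _).mono (by omega)
    · rw [if_pos h2, hH'', (Nat.odd_iff.mpr h2).neg_one_pow, neg_one_mul, ← zero_sub]
      exact .sub _ _

end Hankel
/-! ### The generalized Sturm sequence -/

section Sturm

open Polynomial

variable {K : Type} [Field K]

theorem length_coeffList {P : K[X]} (hP : P ≠ 0) : P.coeffList.length = P.natDegree + 1 := by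
  rw [length_coeffList_eq_withBotSucc_degree, withBotSucc_degree_eq_natDegree_add_one hP]

theorem getD_coeffList (P : K[X]) (i : ℕ) : P.coeffList.getD i 0 = P.reverse.coeff i := by
  rcases eq_or_ne P 0 with rfl | hP
  · simp
  have hlen : P.coeffList.length = P.natDegree + 1 := length_coeffList hP
  rcases lt_or_ge i (P.natDegree + 1) with hi | hi
  · rw [List.getD_eq_getElem _ _ (by omega), coeff_reverse, revAt_le (by omega)]
    simp only [coeffList, List.getElem_map, List.getElem_reverse, List.getElem_range,
      List.length_range, withBotSucc_degree_eq_natDegree_add_one hP]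
    congr 1
  · rw [List.getD_eq_default _ _ (by omega), coeff_eq_zero_of_natDegree_lt]
    exact (reverse_natDegree_le P).trans_lt (by omega)

theorem ser_coeffList (P : K[X]) : ser P.coeffList = (P.reverse : PowerSeries K) := by
  ext i
  rw [coeff_ser, getD_coeffList, coeff_coe]

theorem ser_reverse_coeffList (P : K[X]) : ser P.coeffList.reverse = (P : PowerSeries K) := by
  ext i
  rw [coeff_ser, coeff_coe, coeffList, ← List.map_reverse, List.reverse_reverse]
  rcases lt_or_ge i P.degree.succ with hi | hi
  · rw [List.getD_eq_getElem _ _ (by simpa using hi)]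
    simp
  · rw [List.getD_eq_default _ _ (by simpa using hi)]
    rcases eq_or_ne P 0 with rfl | hP
    · simp
    · rw [← length_coeffList_eq_withBotSucc_degree, length_coeffList hP] at hi
      exact (coeff_eq_zero_of_natDegree_lt (by omega)).symm

theorem natDegree_eq_add_natDegree_div {f g : K[X]} (hg : g ≠ 0) (hdeg : g.degree ≤ f.degree) :
    f.natDegree = g.natDegree + (f / g).natDegree := by
  have h := degree_add_div hg hdeg
  have hf : f ≠ 0 := fun h0 => by
    rw [h0, degree_zero, le_bot_iff, degree_eq_bot] at hdeg
    exact hg hdeg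
  have hq : f / g ≠ 0 := fun h0 => by
    rw [h0, degree_zero, WithBot.add_bot] at h
    exact hf (degree_eq_bot.mp h.symm)
  rw [degree_eq_natDegree hg, degree_eq_natDegree hf, degree_eq_natDegree hq] at h
  exact_mod_cast h.symm

theorem reflect_add_of_natDegree_le (m n : ℕ) {f : K[X]} (hf : f.natDegree ≤ n) :
    reflect (m + n) f = X ^ m * reflect n f := by
  have h := reflect_mul (1 : K[X]) f (F := m) (G := n) (by simp) hf
  rwa [one_mul, reflect_one] at h

/-- Polynomial division with remainder, read off at the leading coefficients, is a division step for
power series. -/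
theorem euclidStep_polynomial {f g : K[X]} (hg : g ≠ 0) (hdeg : g.degree < f.degree) :
    EuclidStep (f.reverse : PowerSeries K) (reflect f.natDegree g : K[X]) (f / g).natDegree
      (f / g).coeffList (g.reverse : PowerSeries K) (reflect g.natDegree (-(f % g)) : K[X]) := by
  have hn := natDegree_eq_add_natDegree_div hg hdeg.le
  have hlt : g.natDegree < f.natDegree := natDegree_lt_natDegree hg hdeg
  have hq : f / g ≠ 0 := fun h0 => by simp [h0] at hn; omega
  have hr : (f % g).degree < g.degree := EuclideanDomain.mod_lt f hg
  have hr' : (f % g).natDegree ≤ g.natDegree := natDegree_le_natDegree hr.le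
  refine ⟨by omega, length_coeffList hq, ?_, ?_, ?_, ?_⟩
  · rw [hn, add_comm, reflect_add_of_natDegree_le _ _ le_rfl]
    simp [reverse]
  · rw [ser_coeffList]
    have h : X ^ (f / g).natDegree * reflect g.natDegree (-(f % g)) =
        (f / g).reverse * g.reverse - f.reverse := by
      have hf : f.reverse = reflect ((f / g).natDegree + g.natDegree) (f / g * g + f % g) := by
        rw [reverse, hn, add_comm, mul_comm (f / g), EuclideanDomain.div_add_mod]
      rw [hf, reflect_add, reflect_mul _ _ le_rfl le_rfl, reflect_add_of_natDegree_le _ _ hr',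
        reflect_neg, reverse, reverse]
      ring
    simpa using congrArg (fun p : K[X] => (p : PowerSeries K)) h
  · simpa [← PowerSeries.coeff_zero_eq_constantCoeff_apply] using hg
  · rw [← PowerSeries.coeff_zero_eq_constantCoeff_apply, coeff_coe, coeff_reflect,
      revAt_le (Nat.zero_le _), Nat.sub_zero, coeff_neg, coeff_eq_zero_of_degree_lt, neg_zero]
    rwa [← degree_eq_natDegree hg]

theorem sturmSeq_succ (f g : K[X]) (i : ℕ) :
    sturmSeq f g (i + 1) = sturmSeq g (-(f % g)) i := by
  induction i using Nat.twoStepInduction with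
  | zero => simp [sturmSeq]
  | one => simp [sturmSeq]
  | more i ih1 ih2 => rw [sturmSeq, ih1, ih2, sturmSeq]

theorem sturmQuot_succ (f g : K[X]) (i : ℕ) :
    sturmQuot f g (i + 1) = sturmQuot g (-(f % g)) i := by
  rw [sturmQuot, sturmQuot, sturmSeq_succ, sturmSeq_succ]

/-- A chain of division steps for the power series belonging to two polynomials follows their
generalized Sturm sequence. -/
theorem EuclidChain.sturm {F G F' G' : PowerSeries K} {s : ℕ} {Bs : List (List K)}
    (hc : EuclidChain F G Bs s F' G') {f g : K[X]} (hdeg : g.degree < f.degree)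
    (hF : F = f.reverse) (hG : G = (reflect f.natDegree g : K[X])) :
    Bs = (List.range Bs.length).map (fun i => (sturmQuot f g i).coeffList) ∧
      (∀ i < Bs.length, sturmSeq f g (i + 1) ≠ 0) ∧
      ∑ i ∈ Finset.range Bs.length, (sturmQuot f g i).natDegree = s ∧
      G' = (reflect (sturmSeq f g Bs.length).natDegree (sturmSeq f g (Bs.length + 1)) : K[X]) ∧
      (sturmSeq f g (Bs.length + 1)).degree < (sturmSeq f g Bs.length).degree := by
  induction hc generalizing f g with
  | nil F G => simpa [sturmSeq] using ⟨hG, hdeg⟩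
  | @cons F G F₁ G₁ F₂ G₂ m s B Bs hs _ ih =>
    have hg : g ≠ 0 := by
      rintro rfl
      have := hs.coeff_eq_zero_and_ne_zero.2
      rw [hG] at this
      simp at this
    have hs' := euclidStep_polynomial hg hdeg
    rw [← hF, ← hG] at hs'
    obtain ⟨rfl, rfl, rfl, rfl⟩ := hs.unique hs'
    have hdeg' : (-(f % g)).degree < g.degree := by
      rw [degree_neg]
      exact EuclideanDomain.mod_lt f hg
    obtain ⟨h1, h2, h3, h4, h5⟩ := ih hdeg' rfl rfl
    refine ⟨?_, ?_, ?_, ?_, ?_⟩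
    · rw [List.length_cons, List.range_succ_eq_map, List.map_cons, List.map_map]
      congr 1
      refine h1.trans (List.map_congr_left fun i _ => ?_)
      rw [Function.comp_apply, Nat.succ_eq_add_one, sturmQuot_succ]
    · rintro (_ | i) hi
      · exact hg
      · rw [sturmSeq_succ]
        exact h2 i (by simpa using hi)
    · rw [List.length_cons, Finset.sum_range_succ', add_comm]
      simp only [sturmQuot_succ, h3]
      rfl
    · rw [List.length_cons, sturmSeq_succ f, sturmSeq_succ f]
      exact h4
    · rw [List.length_cons, sturmSeq_succ f, sturmSeq_succ f]
      exact h5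

/-! ### The Sturm sequence of a rational function -/

theorem natDegree_sturmF₀ (N : K[X]) {D : K[X]} (hD : D.coeff 0 ≠ 0) :
    (sturmF₀ N D).natDegree = max D.natDegree (N.natDegree + 1) := by
  have hD0 : D ≠ 0 := fun h => hD (by simp [h])
  have ht : D.natTrailingDegree = 0 := natTrailingDegree_eq_zero.mpr (Or.inr hD)
  rw [sturmF₀, natDegree_mul (pow_ne_zero _ X_ne_zero) (by simpa using hD0), natDegree_X_pow,
    reverse_natDegree, ht]
  omega

theorem reverse_sturmF₀ (N : K[X]) {D : K[X]} (hD : D.coeff 0 ≠ 0) :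
    (sturmF₀ N D).reverse = D := by
  have ht : D.natTrailingDegree = 0 := natTrailingDegree_eq_zero.mpr (Or.inr hD)
  rw [sturmF₀, reverse_X_pow_mul, reverse, reverse_natDegree, ht, Nat.sub_zero, reverse,
    reflect_reflect]

theorem degree_sturmF₁_lt (N : K[X]) {D : K[X]} (hD : D.coeff 0 ≠ 0) :
    (sturmF₁ N D).degree < (sturmF₀ N D).degree := by
  have h0 := natDegree_sturmF₀ N hD
  have hne : sturmF₀ N D ≠ 0 := fun h => by
    have := reverse_sturmF₀ N hD
    rw [h, reverse_zero] at this
    exact hD (by simp [← this])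
  refine degree_lt_degree ?_
  rw [h0, sturmF₁]
  refine natDegree_mul_le.trans_lt ?_
  have := reverse_natDegree_le N
  rw [natDegree_X_pow]
  omega

theorem reflect_sturmF₁ (N : K[X]) {D : K[X]} (hD : D.coeff 0 ≠ 0) :
    reflect (sturmF₀ N D).natDegree (sturmF₁ N D) = X * N := by
  have h : (sturmF₀ N D).natDegree = D.natDegree - (N.natDegree + 1) + 1 + N.natDegree := by
    rw [natDegree_sturmF₀ N hD]
    omega
  rw [h, sturmF₁, reflect_mul _ _ (by simp) (reverse_natDegree_le N), reverse, reflect_reflect,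
    reflect_monomial, revAt_le (Nat.le_succ _), Nat.succ_sub le_rfl, Nat.sub_self, pow_one]

/-- The Hankel determinants of order greater than `d` of `N / D` vanish if `deg D ≤ d` and
`deg N < d`: the coefficients satisfy a linear recursion of order `d`. -/
theorem hankelDet_eq_zero_of_rational {N D : K[X]} {h : PowerSeries K} {d t : ℕ}
    (hD : D.coeff 0 ≠ 0) (hdD : D.natDegree ≤ d) (hdN : ∀ i, d ≤ i → N.coeff i = 0)
    (hh : (D : PowerSeries K) * h = (N : PowerSeries K)) (ht : d < t) : hankelDet h t = 0 := by
  rw [hankelDet, ← Matrix.exists_mulVec_eq_zero_iff]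
  -- the kernel vector consists of the coefficients of `D` in reverse order
  refine ⟨fun j => if (j : ℕ) ≤ d then D.coeff (d - j) else 0, fun h0 => hD ?_, ?_⟩
  · simpa using congrFun h0 ⟨d, ht⟩
  · ext i
    have hc := congrArg (PowerSeries.coeff ((i : ℕ) + d)) hh
    rw [coeff_coe, hdN _ (by omega), mul_comm, PowerSeries.coeff_mul,
      Finset.Nat.sum_antidiagonal_eq_sum_range_succ
        (fun a b => PowerSeries.coeff a h * PowerSeries.coeff b (D : PowerSeries K))] at hc
    have hsum : ∑ j ∈ Finset.range t, PowerSeries.coeff ((i : ℕ) + j) h *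
        (if j ≤ d then D.coeff (d - j) else 0) = 0 := by
      rw [← Finset.sum_subset (Finset.range_subset_range.mpr (Nat.succ_le_of_lt ht))]
      · refine Eq.trans ?_ hc
        rw [show ((i : ℕ) + d).succ = i + (d + 1) from rfl, Finset.sum_range_add,
          Finset.sum_eq_zero (s := Finset.range i), zero_add]
        · refine Finset.sum_congr rfl fun j hj => ?_
          rw [if_pos (by have := Finset.mem_range.mp hj; omega), coeff_coe, Nat.add_sub_add_left]
        · intro j hj
          have := Finset.mem_range.mp hj
          rw [coeff_coe, coeff_eq_zero_of_natDegree_lt (by omega), mul_zero]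
      · intro j _ hj
        rw [if_neg (by have := Finset.mem_range.not.mp hj; omega), mul_zero]
    rw [Matrix.mulVec, dotProduct]
    simp only [Matrix.of_apply, Pi.zero_apply]
    refine Eq.trans ?_ hsum
    exact Fin.sum_univ_eq_sum_range (fun j => PowerSeries.coeff ((i : ℕ) + j) h *
        (if j ≤ d then D.coeff (d - j) else 0)) t

end Sturm
/-! ### Algorithm CompHD -/

section CompHD

variable {K : Type} [Field K]

theorem take_append_replicate (l : List K) {n j : ℕ} (h : n ≤ l.length + j) :
    (l ++ List.replicate j 0).take n = jet n (ser l) := by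
  have hl : n ≤ (l ++ List.replicate j 0).length := by simpa using h
  rw [← ser_append_replicate l j, ← jet_ser (l ++ List.replicate j 0), take_jet_of_le _ hl,
    jet_ser]

theorem ser_zero_cons (l : List K) : ser (0 :: l) = PowerSeries.X * ser l := by
  simpa using ser_replicate_append 1 l

theorem coeff_eq_zero_of_length_coeffList_le (P : Polynomial K) {i : ℕ}
    (h : P.coeffList.length ≤ i) : P.coeff i = 0 := by
  rcases eq_or_ne P 0 with rfl | hP
  · simp
  · rw [length_coeffList hP] at h
    exact Polynomial.coeff_eq_zero_of_natDegree_lt (by omega)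

variable [DecidableEq K]

/-- The half-GCD step applied to the Sturm sequence of `N / D` works on the pair `(D, x N)`. -/
theorem exists_computes_sturmQuotients {root : ℕ → K} (hr : IsRootTower root) {a k : ℕ}
    (hk : k < 2 ^ a) (N : Polynomial K) {D : Polynomial K} (hD : D.coeff 0 ≠ 0) :
    ∃ R F' G',
      Computes (sturmQuotients root k 0 (sturmInput 0 N.coeffList D.coeffList).1
        (sturmInput 0 N.coeffList D.coeffList).2) R.quots (halfGCDCost a) ∧
      HalfGCDSpec k (D : PowerSeries K) (PowerSeries.X * (N : PowerSeries K)) F' G' R := by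
  have hD0 : D ≠ 0 := fun h => hD (by simp [h])
  have hF : PowerSeries.constantCoeff (D : PowerSeries K) ≠ 0 := by
    rwa [← PowerSeries.coeff_zero_eq_constantCoeff_apply, Polynomial.coeff_coe]
  obtain ⟨R, F', G', hR, hs⟩ := exists_computes_halfGCD hr a hk hF
    (G := PowerSeries.X * (N : PowerSeries K)) (by simp)
  refine ⟨R, F', G', ?_, hs⟩
  rw [sturmQuotients, sturmInput]
  simp only
  rw [take_append_replicate _ (by simp [length_coeffList hD0]),
    take_append_replicate _ (by simp), ser_zero_cons, ser_append_replicate,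
    ser_append_replicate, ser_reverse_coeffList, ser_reverse_coeffList]
  exact Computes.bind (c' := 0) hR (.pure R.quots)

/-- Correctness and cost of the algorithm. -/
theorem computes_compHD {root : ℕ → K} (hr : IsRootTower root) {a n : ℕ} {N D : Polynomial K}
    {h : PowerSeries K} (hD : D.coeff 0 ≠ 0)
    (hh : (D : PowerSeries K) * h = (N : PowerSeries K))
    (ha : min n (max (D.coeffList.length - 1) N.coeffList.length) < 2 ^ a) :
    Computes (compHD root n N.coeffList D.coeffList)
      ((List.range n).map fun i => hankelDet h (i + 1)) (2 + halfGCDCost a + 7 * 2 ^ a) := by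
  have hD0 : D ≠ 0 := fun h => hD (by simp [h])
  have hF : PowerSeries.constantCoeff (D : PowerSeries K) ≠ 0 := by
    rwa [← PowerSeries.coeff_zero_eq_constantCoeff_apply, Polynomial.coeff_coe]
  obtain ⟨R, F', G', hR, hs⟩ := exists_computes_sturmQuotients hr ha N hD
  have hX : PowerSeries.X * h * (D : PowerSeries K) =
      PowerSeries.X * (N : PowerSeries K) := by
    rw [← hh]
    ring
  have hH := hs.chain.computes_hankelRec hF hX 1 one_ne_zero
  have hle := hs.le
  have hres : ((List.range n).map fun i => hankelDet h (i + 1)) =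
      ((List.range R.s).map fun i => 1 * 1⁻¹ ^ (i + 1) * hankelDet h (i + 1)) ++
        List.replicate (n - ((List.range R.s).map fun i =>
          1 * 1⁻¹ ^ (i + 1) * hankelDet h (i + 1)).length) 0 := by
    obtain ⟨r, rfl⟩ : ∃ r, n = R.s + r := ⟨n - R.s, by omega⟩
    rw [List.range_add, List.map_append, List.map_map]
    congr 1
    · simp
    · refine List.ext_getElem (by simp) fun i hi _ => ?_
      have hir : i < r := by simpa using hi
      simp only [List.getElem_map, List.getElem_range, Function.comp_apply,
        List.getElem_replicate]
      -- orders up to `d` are covered by the half-GCD, larger ones vanish as the rank is at most `d`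
      rcases lt_or_ge (max (D.coeffList.length - 1) N.coeffList.length) (R.s + i + 1) with hd | hd
      · exact hankelDet_eq_zero_of_rational hD (by rw [length_coeffList hD0]; omega)
          (fun j hj => coeff_eq_zero_of_length_coeffList_le N (by omega)) hh hd
      · rw [add_assoc]
        exact hs.chain.hankelDet_eq_zero hF hX hs.coeff_eq_zero (by omega) (by omega)
  rw [compHD, hres]
  refine Computes.mono (.bind (.const _) (.bind (.const _) (.bind hR (.bind hH (.pure _))))) ?_
  omega

end CompHD

theorem isRootTower_complexRoot : IsRootTower complexRoot := by
  refine ⟨fun e => ?_, fun e => ?_⟩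
  · have h := Complex.isPrimitiveRoot_exp (2 ^ e) (by positivity)
    rw [complexRoot]
    simpa using h
  · rw [complexRoot, complexRoot, ← Complex.exp_nat_mul]
    congr 1
    rw [pow_succ]
    field_simp
    norm_num

/-- The bound `O(m log² m)` for the cost, with the power of two `2 ^ (L + 1)` above `m`, where
`L = ⌊log₂ m⌋`. For `m ≥ 2` it follows from `L + 2 ≤ 3 L`, `2 ^ (L + 1) ≤ 2 m`, `L ≤ 2 log m` and
`81864 = 1137 * 9 * 2 * 4`. -/
theorem cost_le (m : ℕ) :
    (2 ≤ m → ((2 + halfGCDCost (Nat.log 2 m + 1) + 7 * 2 ^ (Nat.log 2 m + 1) : ℕ) : ℝ) ≤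
      81864 * (m * Real.log m ^ 2)) ∧
    (m ≤ 1 → ((2 + halfGCDCost (Nat.log 2 m + 1) + 7 * 2 ^ (Nat.log 2 m + 1) : ℕ) : ℝ) ≤
      81864) := by
  refine ⟨fun hm => ?_, fun hm => ?_⟩
  · set L := Nat.log 2 m with hL
    have hL1 : 1 ≤ L := Nat.log_pos one_lt_two hm
    have hpow : 2 ^ L ≤ m := Nat.pow_log_le_self 2 (by omega)
    have h1 : (2 + halfGCDCost (L + 1) + 7 * 2 ^ (L + 1) : ℕ) ≤ 1137 * (3 * L) ^ 2 * (2 * m) := by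
      have h2 : (L + 1 + 1) ^ 2 ≤ (3 * L) ^ 2 := Nat.pow_le_pow_left (by omega) 2
      have h3 : 2 ^ (L + 1) ≤ 2 * m := by rw [pow_succ]; omega
      have h4 : 1 ≤ (3 * L) ^ 2 := Nat.one_le_pow _ _ (by omega)
      calc 2 + halfGCDCost (L + 1) + 7 * 2 ^ (L + 1)
          ≤ 2 * (3 * L) ^ 2 * (2 * m) + 1128 * (3 * L) ^ 2 * (2 * m) +
              7 * (3 * L) ^ 2 * (2 * m) := by
            refine Nat.add_le_add (Nat.add_le_add ?_ ?_) (Nat.mul_le_mul ?_ h3)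
            · nlinarith
            · exact Nat.mul_le_mul (Nat.mul_le_mul le_rfl h2) h3
            · omega
        _ = _ := by ring
    have hlog : (L : ℝ) ≤ 2 * Real.log m := by
      have h2 : (L : ℝ) * Real.log 2 ≤ Real.log m := by
        rw [← Real.log_pow]
        exact Real.log_le_log (by positivity) (by exact_mod_cast hpow)
      have h3 := Real.log_two_gt_d9
      have h4 : (0 : ℝ) ≤ L := Nat.cast_nonneg L
      nlinarith
    calc ((2 + halfGCDCost (L + 1) + 7 * 2 ^ (L + 1) : ℕ) : ℝ)
        ≤ ((1137 * (3 * L) ^ 2 * (2 * m) : ℕ) : ℝ) := by exact_mod_cast h1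
      _ = 20466 * (m * (L : ℝ) ^ 2) := by push_cast; ring
      _ ≤ 20466 * (m * (2 * Real.log m) ^ 2) := by gcongr
      _ = 81864 * (m * Real.log m ^ 2) := by ring
  · have h : Nat.log 2 m = 0 := Nat.log_of_lt (by omega)
    rw [h]
    norm_num [halfGCDCost]

end HankelAlg

theorem mainTheorem6 :
    ∃ C : ℝ, 0 < C ∧
      ∀ (n : ℕ) (N D : Polynomial ℂ) (h : PowerSeries ℂ),
        IsCoprime N D →
        -- `h = N / D` as power series
        (D : PowerSeries ℂ) * h = (N : PowerSeries ℂ) →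
        let d := max D.natDegree (N.natDegree + 1)
        let m := min n d
        let f₀ := HankelAlg.sturmF₀ N D
        let f₁ := HankelAlg.sturmF₁ N D
        let f := HankelAlg.sturmInput 0 N.coeffList D.coeffList
        -- CompHD returns `H_1, …, H_n` and performs `c` operations
        (∃ c : ℕ,
          (HankelAlg.compHD HankelAlg.complexRoot n N.coeffList D.coeffList).run =
            some ((List.range n).map (fun i => HankelAlg.hankelDet h (i + 1)), c) ∧
          (2 ≤ m → (c : ℝ) ≤ C * (m * Real.log m ^ 2)) ∧
          (m ≤ 1 → (c : ℝ) ≤ C)) ∧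
        -- its half-GCD step returns the quotients `B_0, …, B_{κ-1}` of the generalized Sturm
        -- sequence of `f₀, f₁`, with `κ` maximal such that `deg B_0 + … + deg B_{κ-1} ≤ m`
        (∃ κ c : ℕ,
          (HankelAlg.sturmQuotients HankelAlg.complexRoot m 0 f.1 f.2).run =
            some ((List.range κ).map (fun i => (HankelAlg.sturmQuot f₀ f₁ i).coeffList), c) ∧
          (∀ i < κ, HankelAlg.sturmSeq f₀ f₁ (i + 1) ≠ 0) ∧
          ∑ i ∈ Finset.range κ, (HankelAlg.sturmQuot f₀ f₁ i).natDegree ≤ m ∧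
          (HankelAlg.sturmSeq f₀ f₁ (κ + 1) ≠ 0 →
            m < ∑ i ∈ Finset.range (κ + 1), (HankelAlg.sturmQuot f₀ f₁ i).natDegree) ∧
          (2 ≤ m → (c : ℝ) ≤ C * (m * Real.log m ^ 2)) ∧
          (m ≤ 1 → (c : ℝ) ≤ C)) := by
  refine ⟨81864, by norm_num, fun n N D h hcop hh => ?_⟩
  intro d m f₀ f₁ f
  -- `D(0) = 0` would force `N(0) = 0`, against coprimality
  have hD : D.coeff 0 ≠ 0 := by
    intro h0
    have hN : N.coeff 0 = 0 := by
      have hc := congrArg (PowerSeries.coeff 0) hh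
      rw [Polynomial.coeff_coe, PowerSeries.coeff_mul] at hc
      simpa [h0] using hc.symm
    obtain ⟨u, v, huv⟩ := hcop
    have hc := congrArg (Polynomial.coeff · 0) huv
    simp [Polynomial.mul_coeff_zero, hN, h0] at hc
  have hD0 : D ≠ 0 := fun h => hD (by simp [h])
  have hm : m < 2 ^ (Nat.log 2 m + 1) := Nat.lt_pow_succ_log_self one_lt_two m
  have hcost := HankelAlg.cost_le m
  have hbound : ∀ c : ℕ,
      c ≤ 2 + HankelAlg.halfGCDCost (Nat.log 2 m + 1) + 7 * 2 ^ (Nat.log 2 m + 1) →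
      (2 ≤ m → (c : ℝ) ≤ 81864 * (m * Real.log m ^ 2)) ∧ (m ≤ 1 → (c : ℝ) ≤ 81864) :=
    fun c hc => ⟨fun h2 => (Nat.cast_le.mpr hc).trans (hcost.1 h2),
      fun h1 => (Nat.cast_le.mpr hc).trans (hcost.2 h1)⟩
  constructor
  · -- for `N = 0` the program uses `deg D` in place of `max (deg D) 1`
    have hle : min n (max (D.coeffList.length - 1) N.coeffList.length) ≤ m := by
      have hN : N.coeffList.length ≤ N.natDegree + 1 := by
        rcases eq_or_ne N 0 with rfl | hN
        · simp
        · exact (HankelAlg.length_coeffList hN).le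
      rw [HankelAlg.length_coeffList hD0]
      omega
    obtain ⟨c, hc, hrun⟩ := HankelAlg.computes_compHD HankelAlg.isRootTower_complexRoot
      (n := n) hD hh (hle.trans_lt hm)
    exact ⟨c, hrun, hbound c hc⟩
  · obtain ⟨R, F', G', ⟨c, hc, hrun⟩, hs⟩ :=
      HankelAlg.exists_computes_sturmQuotients HankelAlg.isRootTower_complexRoot hm N hD
    obtain ⟨h1, h2, h3, h4, h5⟩ := hs.chain.sturm (HankelAlg.degree_sturmF₁_lt N hD)
      (by rw [HankelAlg.reverse_sturmF₀ N hD]) (by rw [HankelAlg.reflect_sturmF₁ N hD]; simp)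
    refine ⟨R.quots.length, c, ?_, h2, h3.le.trans hs.le, fun hne => ?_, hbound c (by omega)⟩
    · rw [hrun, ← h1]
    · rw [Finset.sum_range_succ, h3]
      by_contra hcon
      -- the next quotient would be visible in the vanishing coefficients of `G'`
      refine (HankelAlg.euclidStep_polynomial hne h5).coeff_eq_zero_and_ne_zero.2 ?_
      rw [← h4]
      exact hs.coeff_eq_zero _ (Nat.le_sub_of_add_le' (not_lt.mp hcon))
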